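/- Let $q\in\{1,2\}$ and $h(z)=\int_0^\infty e^{-tz}\,\mu(dt)$, where $\mu$ is a finite nonzero measure on $[0,\infty)$ whose support is bounded and bounded away from zero: $0<m_\mu:=\inf\operatorname{supp}\mu$ and $M_\mu:=\sup\operatorname{supp}\mu<\infty$. Let $\mathbb Q$ be the law of $(X,Y)\in\mathbb R^p\times\mathbb R$ with $\mathbb E[Y]=0$, with $\|X\|_\infty\le M_X<\infty$ and $|Y|\le M_Y<\infty$ almost surely, and with $\operatorname{Var}(X_l)>0$ for all $l\in[p]$. Let the signal set $S\subseteq[p]$ be the minimal set such that $\mathbb E[Y\mid X]=\mathbb E[Y\mid X_S]$ almost surely and $X_S$ is independent of $X_{S^c}$ under $\mathbb Q$, and assume $S\neq\emptyset$. For a probability measure $R$ on $\mathbb R^p\times\mathbb R$ put $$F^{\rm ML}(\beta;R)=-\mathbb E\Big[YY'\,h\Big(\sum_{i=1}^p\beta_i|X_i-X_i'|^q\Big)\Big],$$ where $(X,Y)$ and $(X',Y')$ are independent with law $R$. Let $\mathcal B=\{\beta\in\mathbb R^p:\beta\ge0,\ \|\beta\|_\infty\le M\}$ with normal cone $N_{\mathcal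 B}$, and fix $\beta_0\in\mathcal B$ with full support, i.e. all coordinates of $\beta_0$ nonzero. Let $\mathbb Q_n$ be the empirical distribution of $n$ i.i.d. samples from $\mathbb Q$. Then there are constants $c,\tau>0$ and $n_0\in\mathbb N$, independent of $n$, such that for every $n\ge n_0$, with probability at least $1-e^{-cn}$, the projected gradient flow $$\dot\beta(t)\in-\nabla F^{\rm ML}(\beta(t);\mathbb Q_n)-N_{\mathcal B}(\beta(t)),\qquad \beta(0)=\beta_0,$$ has a solution on $[0,\infty)$ (a locally absolutely continuous curve satisfying the inclusion for almost every $t\ge 0$), and every such solution satisfies $$\emptyset\neq\operatorname{supp}(\beta(t))=\{j:\beta_j(t)\neq0\}\subseteq S\qquad\text{for all }t\ge\tau .$$ -/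

import Mathlib

open MeasureTheory ProbabilityTheory

namespace MetricLearning

noncomputable section

/-- A data point `z = (x, y)`: the feature vector `z.1 = x` and the response `z.2 = y`. -/
abbrev Data (p : ℕ) : Type := (Fin p → ℝ) × ℝ

/-! ### The kernel profile and the objective -/

/-- `h(z) = ∫ e^{-t z} μ(dt)`. The measure `μ` lives on `[0, ∞)`, see `KernelAssumption`. -/
def kernelProfile (μ : Measure ℝ) (z : ℝ) : ℝ := ∫ t, Real.exp (-t * z) ∂μ

/-- `μ` is a measure on `[0, ∞)` whose support is bounded and bounded away from zero:
`0 < m_μ` and `M_μ < ∞`, where `m_μ` and `M_μ` are the infimum and supremum of the support.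
One-point supports (such as `h(z) = e^{-z}`) are allowed; `0 < m_μ` forces `μ ≠ 0`, because the
infimum of the empty set is `0`. -/
structure KernelAssumption (μ : Measure ℝ) : Prop where
  nonneg : μ (Set.Iio 0) = 0
  inf_support_pos : 0 < sInf μ.support
  bddAbove_support : BddAbove μ.support

/-- The weighted norm power `‖v‖_{q,β}^q = ∑ i, β_i |v_i|^q`. -/
def weightedNormPow {p : ℕ} (q : ℕ) (β : EuclideanSpace ℝ (Fin p)) (v : Fin p → ℝ) : ℝ :=
  ∑ i, β i * |v i| ^ q

/-- The metric learning objective `F(β; Q) = -E[Y Y' h(‖X - X'‖_{q,β}^q)]`, where `(X, Y)` and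
`(X', Y')` are independent with law `Q`. -/
def mlObjective {p : ℕ} (μ : Measure ℝ) (q : ℕ) (Q : Measure (Data p))
    (β : EuclideanSpace ℝ (Fin p)) : ℝ :=
  -∫ w : Data p × Data p,
    w.1.2 * w.2.2 * kernelProfile μ (weightedNormPow q β (w.1.1 - w.2.1)) ∂(Q.prod Q)

/-- The empirical distribution `Q_n = (1/n) ∑ i, δ_{z_i}` of a sample of size `n`. -/
def empiricalMeasure {p n : ℕ} (z : Fin n → Data p) : Measure (Data p) :=
  (n : ENNReal)⁻¹ • ∑ i, Measure.dirac (z i)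

/-! ### The population distribution and its signal set -/

/-- The response is centered, the data are (almost surely) bounded, and no coordinate of the
features is degenerate. The norm on `Fin p → ℝ` is the sup norm. -/
structure DataAssumption {p : ℕ} (Q : Measure (Data p)) : Prop where
  centered : ∫ z, z.2 ∂Q = 0
  bounded_features : ∃ MX : ℝ, ∀ᵐ z ∂Q, ‖z.1‖ ≤ MX
  bounded_response : ∃ MY : ℝ, ∀ᵐ z ∂Q, |z.2| ≤ MY
  variance_pos : ∀ l, 0 < variance (fun z : Data p => z.1 l) Q

/-- The subvector `X_T` of the features. -/
def subFeatures {p : ℕ} (T : Finset (Fin p)) (z : Data p) : T → ℝ := fun i => z.1 i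

/-- `T` carries all the signal and is independent of the rest: `E[Y | X] = E[Y | X_T]` almost
surely, and `X_T` is independent of `X_{T^c}`. -/
def SeparatesSignal {p : ℕ} (Q : Measure (Data p)) (T : Finset (Fin p)) : Prop :=
  (Q[fun z => z.2 | MeasurableSpace.comap (fun z : Data p => z.1) inferInstance] =ᵐ[Q]
    Q[fun z => z.2 | MeasurableSpace.comap (subFeatures T) inferInstance]) ∧
  IndepFun (subFeatures T) (subFeatures Tᶜ) Q

/-- The signal set: the minimal set of features that separates the signal. -/
def IsSignalSet {p : ℕ} (Q : Measure (Data p)) (S : Finset (Fin p)) : Prop :=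
  Minimal (SeparatesSignal Q) S

/-! ### The projected gradient flow -/

/-- The feasible box `{β : β ≥ 0, ‖β‖_∞ ≤ M}`. -/
def feasibleBox (p : ℕ) (M : ℝ) : Set (EuclideanSpace ℝ (Fin p)) :=
  {β | ∀ i, 0 ≤ β i ∧ β i ≤ M}

/-- The normal cone to `B` at `x`; it is empty if `x ∉ B`. -/
def normalCone {E : Type*} [NormedAddCommGroup E] [InnerProductSpace ℝ E]
    (B : Set E) (x : E) : Set E :=
  {v | x ∈ B ∧ ∀ y ∈ B, inner ℝ v (y - x) ≤ 0}

/-- `x` solves the differential inclusion `x' ∈ G(x)` on `[0, ∞)` with `x(0) = x₀`: it is the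
integral of a locally integrable velocity field that lies in `G(x(t))` for almost every `t`. -/
def SolvesInclusion {E : Type*} [NormedAddCommGroup E] [NormedSpace ℝ E]
    (G : E → Set E) (x₀ : E) (x : ℝ → E) : Prop :=
  ∃ v : ℝ → E,
    (∀ t, 0 ≤ t → IntervalIntegrable v volume 0 t) ∧
    (∀ᵐ t ∂(volume : Measure ℝ), 0 ≤ t → v t ∈ G (x t)) ∧
    ∀ t, 0 ≤ t → x t = x₀ + ∫ s in (0 : ℝ)..t, v s

/-- The projected gradient flow of `F` on `B` from `x₀`:
`x' ∈ -∇F(x) - N_B(x)`, `x(0) = x₀ ∈ B`. -/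
def IsProjectedGradientFlow {E : Type*} [NormedAddCommGroup E] [InnerProductSpace ℝ E]
    [CompleteSpace E] (F : E → ℝ) (B : Set E) (x₀ : E) (x : ℝ → E) : Prop :=
  x₀ ∈ B ∧ SolvesInclusion (fun y => {v | ∃ w ∈ normalCone B y, v = -gradient F y - w}) x₀ x

/-- The set of active coordinates of a vector. -/
def coordSupport {p : ℕ} (β : EuclideanSpace ℝ (Fin p)) : Set (Fin p) := {j | β j ≠ 0}

end

end MetricLearning

/-! The population objective is minus an average of squared Fourier coefficients. For `q = 1` or `q
= 2` each kernel `exp (-a * |u| ^ q)` with `a ≥ 0` is the characteristic function of a finite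
measure, so `kernelForm_eq_integral` writes `E[Y Y' exp (-∑ a_i |X_i - X_i'|^q)]` as the integral of
`|E[Y exp (i ω·X)]|²`. Hence the objective is nonpositive on the box. At full-support weights the
frequency measure has full support, so a zero value would force `E[Y | X] = 0`; minimality and
nonemptiness of `S` exclude this (`mlObjective_neg`).

Separation splits the form into a nonnegative signal factor and a noise factor. Differentiating in a
noise direction `l` changes only the noise factor, which stays bounded below. So the partial
derivative is at least a positive multiple of minus the objective (`exists_mul_neg_mlObjective_le`):
as long as the objective is strictly negative, noise coordinates are pushed down at a definite rate.

Both facts survive sampling. The integrands are equicontinuous on compact sets, so finitely many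
cell frequencies control the objective and its partial derivatives uniformly over the box, and
Hoeffding's inequality handles the frequencies (`exists_uniform_concentration`). Along the empirical
flow the objective never exceeds its initial value (`IsProjectedGradientFlow.le_initial`), hence
stays away from its value near `0` at the origin: some coordinate survives. The noise derivatives
stay above a fixed positive constant, so those coordinates reach zero by a fixed time and remain
there (`IsProjectedGradientFlow.coord_eq_zero`). Existence of the flow comes from limits of
projected Euler schemes (`exists_solvesInclusion`). -/

namespace MetricLearning

open Set Filter Topology
open scoped NNReal ENNReal

/-! ### Existence of projected flows by the Euler scheme. -/

section Existence

variable {E : Type*} [NormedAddCommGroup E] [InnerProductSpace ℝ E]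

/-- Projection onto a closed convex set is quasi-nonexpansive with respect to its points. -/
theorem exists_norm_sub_le_of_convex [CompleteSpace E] {B : Set E} (hB : IsClosed B)
    (hconv : Convex ℝ B) (hne : B.Nonempty) (u : E) :
    ∃ v ∈ B, ∀ y ∈ B, ‖v - y‖ ≤ ‖u - y‖ := by
  obtain ⟨v, hv, hmin⟩ := exists_norm_eq_iInf_of_complete_convex hne hB.isComplete hconv u
  refine ⟨v, hv, fun y hy => ?_⟩
  have h := (norm_eq_iInf_iff_real_inner_le_zero hconv hv).1 hmin y hy
  have h1 : ‖u - y‖ ^ 2 = ‖u - v‖ ^ 2 - 2 * inner ℝ (u - v) (y - v) + ‖v - y‖ ^ 2 := by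
    rw [show u - y = (u - v) - (y - v) by abel, norm_sub_sq_real, norm_sub_rev v y]
  refine le_of_sq_le_sq ?_ (norm_nonneg _)
  nlinarith [sq_nonneg ‖u - v‖]

/-- The explicit Euler scheme with step `η`, followed by a map `P` after each step. -/
noncomputable def projectedEuler (P g : E → E) (η : ℝ) (x₀ : E) : ℕ → E
  | 0 => x₀
  | k + 1 => P (projectedEuler P g η x₀ k - η • g (projectedEuler P g η x₀ k))

variable {B : Set E} {P g : E → E} {η G : ℝ} {x₀ : E}

theorem projectedEuler_mem (hP : ∀ u, P u ∈ B) (hx₀ : x₀ ∈ B) (k : ℕ) :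
    projectedEuler P g η x₀ k ∈ B := by
  cases k with
  | zero => exact hx₀
  | succ k => exact hP _

/-- The current iterate lies in `B`, so projecting cannot increase the distance to it: a step moves
no further than `η * G`. -/
theorem norm_projectedEuler_sub_le (hP : ∀ u, P u ∈ B) (hPn : ∀ u, ∀ y ∈ B, ‖P u - y‖ ≤ ‖u - y‖)
    (hx₀ : x₀ ∈ B) (hη : 0 ≤ η) (hG : ∀ x ∈ B, ‖g x‖ ≤ G) (k m : ℕ) :
    ‖projectedEuler P g η x₀ (k + m) - projectedEuler P g η x₀ k‖ ≤ m * η * G := by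
  induction m with
  | zero => simp
  | succ m ih =>
    set x := projectedEuler P g η x₀ with hx
    have hmem : ∀ j, x j ∈ B := projectedEuler_mem hP hx₀
    have h1 : ‖x (k + m + 1) - x (k + m)‖ ≤ η * G := by
      refine (hPn _ _ (hmem _)).trans ?_
      rw [sub_sub_cancel_left, norm_neg, norm_smul, Real.norm_of_nonneg hη]
      exact mul_le_mul_of_nonneg_left (hG _ (hmem _)) hη
    have h2 := norm_sub_le_norm_sub_add_norm_sub (x (k + m + 1)) (x (k + m)) (x k)
    rw [← add_assoc]
    push_cast
    linarith

/-- Discrete evolution variational inequality of the projected Euler scheme. -/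
theorem projectedEuler_sq_sub_le (hP : ∀ u, P u ∈ B)
    (hPn : ∀ u, ∀ y ∈ B, ‖P u - y‖ ≤ ‖u - y‖)
    (hx₀ : x₀ ∈ B) (hη : 0 ≤ η) (hG : ∀ x ∈ B, ‖g x‖ ≤ G) {y : E} (hy : y ∈ B) {δ ε : ℝ}
    (hmod : ∀ x ∈ B, ∀ x' ∈ B, ‖x' - x‖ < δ → inner ℝ (g x) (x - y) - ε ≤ inner ℝ (g x') (x' - y))
    (k m : ℕ) (hm : m * η * G < δ) :
    ‖projectedEuler P g η x₀ (k + m) - y‖ ^ 2 - ‖projectedEuler P g η x₀ k - y‖ ^ 2 ≤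
      2 * (m * η) * (-inner ℝ (g (projectedEuler P g η x₀ k)) (projectedEuler P g η x₀ k - y) + ε)
        + m * η * (η * G ^ 2) := by
  have hG0 : 0 ≤ G := (norm_nonneg _).trans (hG _ hx₀)
  induction m with
  | zero => simp
  | succ m ih =>
    set x := projectedEuler P g η x₀ with hx
    have hmem : ∀ j, x j ∈ B := projectedEuler_mem hP hx₀
    push_cast at hm ⊢
    have hm' : m * η * G < δ := by nlinarith [mul_nonneg hη hG0]
    have h1 := ih hm'
    have h2 : ‖x (k + m + 1) - y‖ ^ 2 ≤ ‖x (k + m) - η • g (x (k + m)) - y‖ ^ 2 :=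
      pow_le_pow_left₀ (norm_nonneg _) (hPn _ _ hy) 2
    rw [show x (k + m) - η • g (x (k + m)) - y = (x (k + m) - y) - η • g (x (k + m)) by abel,
      norm_sub_sq_real (x (k + m) - y), inner_smul_right, norm_smul, Real.norm_of_nonneg hη,
      real_inner_comm] at h2
    have h3 := hmod (x k) (hmem _) (x (k + m)) (hmem _)
      ((norm_projectedEuler_sub_le hP hPn hx₀ hη hG k m).trans_lt hm')
    have h4 : (η * ‖g (x (k + m))‖) ^ 2 ≤ η * (η * G ^ 2) := by
      have := pow_le_pow_left₀ (norm_nonneg _) (hG _ (hmem (k + m))) 2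
      rw [mul_pow, sq η, mul_assoc]
      gcongr
    rw [← add_assoc]
    nlinarith [mul_le_mul_of_nonneg_left h3 hη]

/-- The number of Euler steps of length `1 / (n + 1)` between times `s` and `t`, times the step
length, recovers the elapsed time. -/
theorem tendsto_natFloor_sub_div (s t : ℝ) (hs : 0 ≤ s) (hst : s ≤ t) :
    Tendsto (fun n : ℕ => ((⌊t * (n + 1)⌋₊ - ⌊s * (n + 1)⌋₊ : ℕ) : ℝ) * (1 / ((n : ℝ) + 1)))
      atTop (𝓝 (t - s)) := by
  have key : ∀ r : ℝ, 0 ≤ r → Tendsto (fun n : ℕ => (⌊r * (n + 1)⌋₊ : ℝ) * (1 / ((n : ℝ) + 1)))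
      atTop (𝓝 r) := by
    intro r hr
    have h := (tendsto_nat_floor_mul_div_atTop (R := ℝ) hr).comp
      (tendsto_natCast_atTop_atTop.atTop_add (tendsto_const_nhds (x := (1 : ℝ))) :
        Tendsto (fun n : ℕ => (n : ℝ) + 1) atTop atTop)
    refine h.congr fun n => ?_
    simp [div_eq_mul_inv]
  refine ((key t (hs.trans hst)).sub (key s hs)).congr fun n => ?_
  rw [Nat.cast_sub (Nat.floor_le_floor (by gcongr)), sub_mul]

/-- Limit of the projected Euler scheme: a Lipschitz curve in `B` which satisfies the evolution
variational inequality on short time intervals. -/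
theorem exists_evolutionVariational [CompleteSpace E] (hB : IsCompact B) (hconv : Convex ℝ B)
    (hx₀ : x₀ ∈ B) (hg : ContinuousOn g B) :
    ∃ x : ℝ → E, ∃ K : ℝ≥0, x 0 = x₀ ∧ (∀ t, x t ∈ B) ∧ LipschitzWith K x ∧
      ∀ y ∈ B, ∀ ε > 0, ∃ r > 0, ∀ s t, 0 ≤ s → s ≤ t → t - s < r →
        ‖x t - y‖ ^ 2 - ‖x s - y‖ ^ 2 ≤ 2 * (t - s) * (-inner ℝ (g (x s)) (x s - y) + ε) := by
  obtain ⟨G, hG⟩ := hB.exists_bound_of_continuousOn hg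
  have hG0 : 0 ≤ G := (norm_nonneg _).trans (hG _ hx₀)
  choose P hP hPn using exists_norm_sub_le_of_convex hB.isClosed hconv ⟨x₀, hx₀⟩
  set X : ℕ → ℝ → E := fun n t => projectedEuler P g (1 / ((n : ℝ) + 1)) x₀ ⌊t * (n + 1)⌋₊ with hX
  have hη : ∀ n : ℕ, 0 ≤ 1 / ((n : ℝ) + 1) := fun n => by positivity
  have hXm : ∀ n t, X n t ∈ B := fun n t => projectedEuler_mem hP hx₀ _
  -- An ultrafilter replaces the extraction of a subsequence: compactness of `B` gives a limit at
  -- every time at once.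
  let U : Ultrafilter ℕ := hyperfilter ℕ
  have hU : (U : Filter ℕ) ≤ atTop := Nat.hyperfilter_le_atTop
  have hlim : ∀ t, ∃ z ∈ B, Tendsto (fun n => X n t) U (𝓝 z) := by
    intro t
    have := isCompact_iff_ultrafilter_le_nhds'.1 hB (U.map fun n => X n t)
      (Filter.mem_map.2 (Eventually.of_forall fun n => hXm n t))
    exact this
  choose x hxB hx using hlim
  have hinv : Tendsto (fun n : ℕ => 1 / ((n : ℝ) + 1)) U (𝓝 0) :=
    tendsto_one_div_add_atTop_nhds_zero_nat.mono_left hU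
  have hle : ∀ (n : ℕ) (s t : ℝ), s ≤ t → ⌊s * (n + 1)⌋₊ ≤ ⌊t * (n + 1)⌋₊ :=
    fun n s t h => Nat.floor_le_floor (by gcongr)
  have hlip0 : ∀ s t, 0 ≤ s → s ≤ t → ‖x t - x s‖ ≤ G * (t - s) := by
    intro s t hs hst
    have h1 : Tendsto (fun n => ‖X n t - X n s‖) U (𝓝 ‖x t - x s‖) := ((hx t).sub (hx s)).norm
    have h2 := (((tendsto_natFloor_sub_div s t hs hst).mono_left hU).mul_const G)
    rw [mul_comm G]
    refine le_of_tendsto_of_tendsto' h1 h2 fun n => ?_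
    have := norm_projectedEuler_sub_le hP hPn hx₀ (hη n) hG ⌊s * (n + 1)⌋₊
      (⌊t * (n + 1)⌋₊ - ⌊s * (n + 1)⌋₊)
    rwa [Nat.add_sub_cancel' (hle n s t hst)] at this
  -- Truncated floors make the scheme constant at negative times, so the limit is Lipschitz on the
  -- whole line.
  have hneg : ∀ t ≤ 0, x t = x₀ := by
    intro t ht
    refine tendsto_nhds_unique (hx t) (tendsto_const_nhds.congr fun n => ?_)
    have : ⌊t * ((n : ℝ) + 1)⌋₊ = 0 :=
      Nat.floor_of_nonpos (mul_nonpos_of_nonpos_of_nonneg ht (by positivity))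
    simp only [hX, this]
    rfl
  have hlip : ∀ s t, s ≤ t → ‖x t - x s‖ ≤ G * (t - s) := by
    intro s t hst
    rcases le_total 0 s with hs | hs
    · exact hlip0 s t hs hst
    rcases le_total 0 t with ht | ht
    · have := hlip0 0 t le_rfl ht
      rw [hneg s hs, ← hneg 0 le_rfl]
      nlinarith
    · rw [hneg s hs, hneg t ht, sub_self, norm_zero]
      nlinarith
  refine ⟨x, ⟨G, hG0⟩, hneg 0 le_rfl, hxB, LipschitzWith.of_dist_le_mul fun s t => ?_, ?_⟩
  · rcases le_total s t with h | h
    · rw [dist_comm, dist_eq_norm, dist_comm, Real.dist_eq, abs_of_nonneg (sub_nonneg.2 h)]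
      exact hlip s t h
    · rw [dist_eq_norm, Real.dist_eq, abs_of_nonneg (sub_nonneg.2 h)]
      exact hlip t s h
  intro y hy ε hε
  have hφ : ContinuousOn (fun z => inner ℝ (g z) (z - y)) B :=
    hg.inner (continuousOn_id.sub continuousOn_const)
  obtain ⟨δ, hδ, hmod⟩ := Metric.uniformContinuousOn_iff.1
    (hB.uniformContinuousOn_of_continuous hφ) ε hε
  have hmod' : ∀ x ∈ B, ∀ x' ∈ B, ‖x' - x‖ < δ →
      inner ℝ (g x) (x - y) - ε ≤ inner ℝ (g x') (x' - y) := by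
    intro z hz z' hz' h
    have := hmod z' hz' z hz (by rwa [dist_eq_norm])
    rw [Real.dist_eq, abs_lt] at this
    linarith
  -- This forces `(t - s) * G < δ`; the `+ 1` covers `G = 0`.
  refine ⟨δ / (G + 1), by positivity, fun s t hs hst hr => ?_⟩
  have hm := (tendsto_natFloor_sub_div s t hs hst).mono_left hU
  have hsmall : ∀ᶠ n : ℕ in (U : Filter ℕ), ((⌊t * (n + 1)⌋₊ - ⌊s * (n + 1)⌋₊ : ℕ) : ℝ) *
      (1 / ((n : ℝ) + 1)) * G < δ := by
    refine (hm.mul_const G).eventually_lt_const ?_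
    rw [lt_div_iff₀ (by positivity)] at hr
    nlinarith
  have hφx : Tendsto (fun n => inner ℝ (g (X n s)) (X n s - y)) U
      (𝓝 (inner ℝ (g (x s)) (x s - y))) :=
    (hφ (x s) (hxB s)).tendsto.comp
      (tendsto_nhdsWithin_iff.2 ⟨hx s, Eventually.of_forall fun n => hXm n s⟩)
  have hL : Tendsto (fun n => ‖X n t - y‖ ^ 2 - ‖X n s - y‖ ^ 2) U
      (𝓝 (‖x t - y‖ ^ 2 - ‖x s - y‖ ^ 2)) :=
    (((hx t).sub_const y).norm.pow 2).sub (((hx s).sub_const y).norm.pow 2)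
  have hR := (((hm.const_mul 2).mul (hφx.neg.add_const ε))).add (hm.mul (hinv.mul_const (G ^ 2)))
  simp only [zero_mul, mul_zero, add_zero] at hR
  refine le_of_tendsto_of_tendsto hL hR (hsmall.mono fun n hn => ?_)
  have := projectedEuler_sq_sub_le hP hPn hx₀ (hη n) hG hy hmod' ⌊s * (n + 1)⌋₊
      (⌊t * (n + 1)⌋₊ - ⌊s * (n + 1)⌋₊) hn
  rwa [Nat.add_sub_cancel' (hle n s t hst)] at this

/-- By Rademacher the curve is differentiable almost everywhere. It and the primitive of its
derivative are absolutely continuous with the same derivative almost everywhere, so they differ by a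
constant. -/
theorem integral_deriv_eq_sub_of_lipschitzWith [FiniteDimensional ℝ E] {x : ℝ → E} {K : ℝ≥0}
    (hx : LipschitzWith K x) (a b : ℝ) :
    IntervalIntegrable (deriv x) volume a b ∧ ∫ s in a..b, deriv x s = x b - x a := by
  have : CompleteSpace E := FiniteDimensional.complete ℝ E
  have hint : ∀ a b, IntervalIntegrable (deriv x) volume a b := fun a b =>
    (intervalIntegrable_const (c := (K : ℝ))).mono_fun
      (stronglyMeasurable_deriv x).aestronglyMeasurable
      (Eventually.of_forall fun t => by
        simpa using norm_deriv_le_of_lipschitz (x₀ := t) hx)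
  refine ⟨hint a b, ?_⟩
  have hlipI : LipschitzWith K fun t => ∫ s in a..t, deriv x s := by
    refine LipschitzWith.of_dist_le_mul fun s t => ?_
    rw [dist_eq_norm, intervalIntegral.integral_interval_sub_left (hint _ _) (hint _ _),
      Real.dist_eq]
    exact intervalIntegral.norm_integral_le_of_norm_le_const fun u _ =>
      norm_deriv_le_of_lipschitz hx
  have h1 := (hlipI.lipschitzOnWith (s := uIcc a b)).absolutelyContinuousOnInterval
  have h2 := (hx.lipschitzOnWith (s := uIcc a b)).absolutelyContinuousOnInterval
  have hae : ∀ᵐ t, t ∈ uIcc a b → HasDerivAt (fun t => (∫ s in a..t, deriv x s) - x t) 0 t := by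
    filter_upwards [hx.ae_differentiableAt, (hint a b).ae_hasDerivAt_integral] with t h3 h4 ht
    have h5 := (h4 ht a left_mem_uIcc).sub h3.hasDerivAt
    rw [sub_self] at h5
    exact h5
  obtain ⟨C, hC⟩ := (h1.sub h2).const_of_ae_hasDerivAt_zero hae
  have ha := hC a left_mem_uIcc
  have hb := hC b right_mem_uIcc
  simp only [Pi.sub_apply, intervalIntegral.integral_same, zero_sub] at ha hb
  rw [← ha] at hb
  rw [sub_eq_iff_eq_add] at hb
  rw [hb]; abel

/-- The projected flow of a continuous field on a compact convex set exists for all times. -/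
theorem exists_solvesInclusion [FiniteDimensional ℝ E] (hB : IsCompact B) (hconv : Convex ℝ B)
    (hx₀ : x₀ ∈ B) (hg : ContinuousOn g B) :
    ∃ x, SolvesInclusion (fun z => {v | ∃ w ∈ normalCone B z, v = -g z - w}) x₀ x := by
  have : CompleteSpace E := FiniteDimensional.complete ℝ E
  obtain ⟨x, K, h0, hxB, hlip, hevi⟩ := exists_evolutionVariational hB hconv hx₀ hg
  refine ⟨x, deriv x, fun t _ => (integral_deriv_eq_sub_of_lipschitzWith hlip 0 t).1, ?_,
    fun t _ => by rw [(integral_deriv_eq_sub_of_lipschitzWith hlip 0 t).2, h0]; abel⟩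
  filter_upwards [hlip.ae_differentiableAt] with t ht ht0
  -- The normal component is forced. Dividing the variational inequality by the elapsed time and
  -- letting it tend to zero from the right gives the normal cone condition up to `ε`.
  refine ⟨-g (x t) - deriv x t, ⟨hxB t, fun y hy => ?_⟩, by abel⟩
  refine le_of_forall_pos_le_add fun ε hε => ?_
  obtain ⟨r, hr, h⟩ := hevi y hy ε hε
  have hd : HasDerivAt (fun t => ‖x t - y‖ ^ 2) (2 * inner ℝ (x t - y) (deriv x t)) t :=
    (ht.hasDerivAt.sub_const y).norm_sq
  have hslope := (hasDerivWithinAt_iff_tendsto_slope' (by simp)).1 (hd.hasDerivWithinAt (s := Ioi t))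
  have hle : 2 * inner ℝ (x t - y) (deriv x t) ≤ 2 * (-inner ℝ (g (x t)) (x t - y) + ε) := by
    refine le_of_tendsto hslope ?_
    filter_upwards [Ioo_mem_nhdsGT (show t < t + r by linarith)] with s hs
    have := h t s ht0 hs.1.le (by linarith [hs.2])
    rw [slope_def_field, div_le_iff₀ (sub_pos.2 hs.1)]
    linarith
  have e1 : inner ℝ (-g (x t) - deriv x t) (y - x t) =
      inner ℝ (g (x t)) (x t - y) + inner ℝ (x t - y) (deriv x t) := by
    rw [← neg_sub (x t) y, inner_neg_right, inner_sub_left, inner_neg_left,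
      real_inner_comm (deriv x t)]
    ring
  rw [e1]
  linarith

end Existence

end MetricLearning

namespace MetricLearning

open Set Filter Topology
open scoped NNReal ENNReal

/-! ### Energy decay and extinction of coordinates along the flow. -/

section Flow

variable {E : Type*} [NormedAddCommGroup E] [InnerProductSpace ℝ E]

/-- An absolutely continuous curve has its velocity field as derivative almost everywhere. -/
theorem ae_hasDerivAt_of_eq_add_integral [CompleteSpace E] {x v : ℝ → E} {x₀ : E}
    (hv : ∀ t, 0 ≤ t → IntervalIntegrable v volume 0 t)
    (hx : ∀ t, 0 ≤ t → x t = x₀ + ∫ s in (0 : ℝ)..t, v s) :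
    ∀ᵐ t, 0 < t → HasDerivAt x (v t) t := by
  -- Integer endpoints leave a single null set for all times.
  have h := ae_all_iff.2 fun N : ℕ => (hv N N.cast_nonneg).ae_hasDerivAt_integral
  filter_upwards [h] with t ht ht0
  obtain ⟨N, hN⟩ := exists_nat_ge t
  have h1 := (ht N (by rw [uIcc_of_le N.cast_nonneg]; exact ⟨ht0.le, hN⟩) 0 left_mem_uIcc).const_add
    x₀
  refine h1.congr_of_eventuallyEq ?_
  filter_upwards [Ioi_mem_nhds ht0] with s hs using hx s (le_of_lt hs)

theorem continuousOn_of_eq_add_integral {x v : ℝ → E} {x₀ : E}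
    (hv : ∀ t, 0 ≤ t → IntervalIntegrable v volume 0 t)
    (hx : ∀ t, 0 ≤ t → x t = x₀ + ∫ s in (0 : ℝ)..t, v s) : ContinuousOn x (Ici 0) := by
  intro t ht
  have ht : 0 ≤ t := ht
  have h0 : (0 : ℝ) ≤ t + 1 := by linarith
  have h1 := intervalIntegral.continuousOn_primitive_interval' (hv (t + 1) h0) left_mem_uIcc
  rw [uIcc_of_le h0] at h1
  have h2 : ContinuousOn x (Icc 0 (t + 1)) :=
    (continuousOn_const.add h1).congr fun s hs => hx s hs.1
  refine (h2 t ⟨ht, by linarith⟩).mono_of_mem_nhdsWithin ?_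
  filter_upwards [self_mem_nhdsWithin, mem_nhdsWithin_of_mem_nhds (Iio_mem_nhds (lt_add_one t))]
    with s hs hs' using ⟨hs, le_of_lt hs'⟩

/-- Regularity of projected gradient flows: the curve stays in the constraint set, and almost
everywhere its velocity is orthogonal to the normal component. -/
theorem IsProjectedGradientFlow.regularity [CompleteSpace E] {F : E → ℝ} {B : Set E}
    (hB : IsClosed B) {x₀ : E} {x : ℝ → E} (h : IsProjectedGradientFlow F B x₀ x) :
    ∃ v : ℝ → E, (∀ t, 0 ≤ t → IntervalIntegrable v volume 0 t) ∧
      (∀ t, 0 ≤ t → x t = x₀ + ∫ s in (0 : ℝ)..t, v s) ∧ (∀ t, 0 ≤ t → x t ∈ B) ∧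
      ∀ᵐ t, 0 < t → HasDerivAt x (v t) t ∧
        ∃ w ∈ normalCone B (x t), v t = -gradient F (x t) - w ∧ inner ℝ w (v t) = 0 := by
  obtain ⟨-, v, hv, hincl, hx⟩ := h
  have hcont := continuousOn_of_eq_add_integral hv hx
  have hmem : ∀ t, 0 ≤ t → x t ∈ B := by
    intro t ht
    by_contra hcon
    have hae : ∀ᵐ s, 0 ≤ s → x s ∈ B := by
      filter_upwards [hincl] with s hs hs0
      obtain ⟨w, hw, -⟩ := hs hs0
      exact hw.1
    -- The normal cone is empty off `B`, so the curve is in `B` at almost every time, hence at a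
    -- dense set of times; leaving the closed set `B` would last for a whole interval.
    have hnh : ∀ᶠ s in 𝓝[Ici 0] t, x s ∉ B :=
      (hcont t ht).tendsto.eventually (hB.isOpen_compl.mem_nhds hcon)
    obtain ⟨u, hu, hsub⟩ := mem_nhdsGE_iff_exists_Ico_subset.1
      (nhdsWithin_mono t (Ici_subset_Ici.2 ht) hnh)
    obtain ⟨s, hs1, hs2⟩ := (Measure.dense_of_ae hae).inter_open_nonempty _ isOpen_Ioo
      (nonempty_Ioo.2 hu)
    exact hsub ⟨hs1.1.le, hs1.2⟩ (hs2 (ht.trans hs1.1.le))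
  refine ⟨v, hv, hx, hmem, ?_⟩
  filter_upwards [hincl, ae_hasDerivAt_of_eq_add_integral hv hx] with t h1 h2 ht
  obtain ⟨w, hw, hvw⟩ := h1 ht.le
  refine ⟨h2 ht, w, hw, hvw, ?_⟩
  -- The curve stays in `B`, so the normal vector makes this function maximal at `t`, and its
  -- derivative vanishes there.
  have hd : HasDerivAt (fun s => inner ℝ w (x s - x t)) (inner ℝ w (v t)) t := by
    have := (innerSL ℝ w).hasFDerivAt.comp_hasDerivAt t ((h2 ht).sub_const (x t))
    exact this
  refine IsLocalMax.hasDerivAt_eq_zero ?_ hd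
  filter_upwards [Ioi_mem_nhds ht] with s hs
  simpa using hw.2 (x s) (hmem s (le_of_lt hs))

/-- The objective does not exceed its initial value along a projected gradient flow. -/
theorem IsProjectedGradientFlow.le_initial [CompleteSpace E] {F : E → ℝ} {B : Set E}
    (hB : IsCompact B) (hconv : Convex ℝ B) (hF : ContDiff ℝ 1 F) {x₀ : E} {x : ℝ → E}
    (h : IsProjectedGradientFlow F B x₀ x) {t : ℝ} (ht : 0 ≤ t) : F (x t) ≤ F x₀ := by
  obtain ⟨v, hv, hx, hmem, hae⟩ := h.regularity hB.isClosed
  have hgcont : Continuous (gradient F) :=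
    (InnerProductSpace.toDual ℝ E).symm.continuous.comp (hF.continuous_fderiv one_ne_zero)
  obtain ⟨G, hG⟩ := hB.exists_bound_of_continuousOn hgcont.continuousOn
  have hG0 : 0 ≤ G := (norm_nonneg _).trans (hG _ (hmem 0 le_rfl))
  have hsq : ∀ᵐ t, 0 < t → HasDerivAt x (v t) t ∧ inner ℝ (gradient F (x t)) (v t) = -‖v t‖ ^ 2 := by
    filter_upwards [hae] with t h1 ht
    obtain ⟨hd, w, -, hvw, hw⟩ := h1 ht
    refine ⟨hd, ?_⟩
    rw [← real_inner_self_eq_norm_sq]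
    nth_rewrite 2 [hvw]
    rw [inner_sub_left, hw, inner_neg_left]
    ring
  -- The velocity is only known to be locally integrable; the energy identity `⟨∇F, v⟩ = -‖v‖²`
  -- bounds it, which makes the curve Lipschitz and `F ∘ x` absolutely continuous.
  have hvb : ∀ᵐ t, 0 < t → ‖v t‖ ≤ G := by
    filter_upwards [hsq] with t h1 ht
    have h2 := (abs_real_inner_le_norm (gradient F (x t)) (v t)).trans
      (mul_le_mul_of_nonneg_right (hG _ (hmem t ht.le)) (norm_nonneg _))
    rw [(h1 ht).2, abs_neg, abs_of_nonneg (sq_nonneg _), sq] at h2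
    rcases (norm_nonneg (v t)).eq_or_lt with h0 | h0
    · rwa [← h0]
    · exact le_of_mul_le_mul_right h2 h0
  have hlipx : LipschitzOnWith ⟨G, hG0⟩ x (Icc 0 t) := by
    refine LipschitzOnWith.of_dist_le_mul fun a ha b hb => ?_
    rw [dist_eq_norm, hx a ha.1, hx b hb.1, add_sub_add_left_eq_sub,
      intervalIntegral.integral_interval_sub_left (hv a ha.1) (hv b hb.1), Real.dist_eq]
    refine intervalIntegral.norm_integral_le_of_norm_le_const_ae ?_
    filter_upwards [hvb] with s hs hs'
    exact hs ((le_min hb.1 ha.1).trans_lt hs'.1)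
  obtain ⟨K, hK⟩ := hF.contDiffOn.exists_lipschitzOnWith one_ne_zero hconv hB
  have hlip : LipschitzOnWith (K * ⟨G, hG0⟩) (F ∘ x) (uIcc 0 t) := by
    rw [uIcc_of_le ht]
    exact hK.comp hlipx fun s hs => hmem s hs.1
  have hx0 : x 0 = x₀ := by simp [hx 0 le_rfl]
  have key := hlip.absolutelyContinuousOnInterval.integral_deriv_eq_sub
  have hle : 0 ≤ ∫ s in (0 : ℝ)..t, -deriv (F ∘ x) s := by
    refine intervalIntegral.integral_nonneg_of_ae_restrict ht ?_
    have h0 : ∀ᵐ s : ℝ, s ≠ 0 := by simp [ae_iff, measure_singleton]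
    filter_upwards [ae_restrict_of_ae hsq, ae_restrict_of_ae h0, ae_restrict_mem measurableSet_Icc]
      with s h1 h2 h3
    obtain ⟨hd, he⟩ := h1 (lt_of_le_of_ne h3.1 (Ne.symm h2))
    have hgr := ((hF.differentiable one_ne_zero) (x s)).hasGradientAt.hasFDerivAt.comp_hasDerivAt s hd
    have : deriv (F ∘ x) s = -‖v s‖ ^ 2 := by
      rw [hgr.deriv, ← he]; rfl
    simp [this]
  rw [intervalIntegral.integral_neg, key] at hle
  simp only [Function.comp, hx0] at hle
  linarith

theorem isCompact_feasibleBox (p : ℕ) (M : ℝ) : IsCompact (feasibleBox p M) := by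
  have h : IsCompact (univ.pi fun _ : Fin p => Icc (0 : ℝ) M) := isCompact_univ_pi fun _ => isCompact_Icc
  convert h.image (PiLp.continuous_toLp 2 fun _ : Fin p => ℝ) using 1
  ext β
  constructor
  · exact fun hβ => ⟨β.ofLp, fun i _ => hβ i, rfl⟩
  · rintro ⟨b, hb, rfl⟩
    exact fun i => hb i trivial

theorem convex_feasibleBox (p : ℕ) (M : ℝ) : Convex ℝ (feasibleBox p M) := by
  intro x hx y hy a b ha hb hab i
  have := convex_Icc (0 : ℝ) M (hx i) (hy i) ha hb hab
  exact this

/-- A coordinate along which the gradient stays above `κ > 0` vanishes after time `M / κ + 1`. -/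
theorem IsProjectedGradientFlow.coord_eq_zero {p : ℕ} {F : EuclideanSpace ℝ (Fin p) → ℝ} {M κ : ℝ}
    {x₀ : EuclideanSpace ℝ (Fin p)} {x : ℝ → EuclideanSpace ℝ (Fin p)}
    (h : IsProjectedGradientFlow F (feasibleBox p M) x₀ x) (hκ : 0 < κ) (l : Fin p)
    (hgrad : ∀ t, 0 ≤ t → κ ≤ gradient F (x t) l) {t : ℝ} (ht : M / κ + 1 ≤ t) : x t l = 0 := by
  obtain ⟨v, hv, hx, hmem, hae⟩ := h.regularity (isCompact_feasibleBox p M).isClosed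
  have hM : 0 ≤ M := (hmem 0 le_rfl l).1.trans (hmem 0 le_rfl l).2
  have ht0 : 0 ≤ t := le_trans (by positivity) ht
  let L : EuclideanSpace ℝ (Fin p) →L[ℝ] ℝ := EuclideanSpace.proj l
  have hLv : ∀ s, 0 ≤ s → IntervalIntegrable (fun s => v s l) volume 0 s := fun s hs =>
    ⟨L.integrable_comp (hv s hs).1, L.integrable_comp (hv s hs).2⟩
  have hxl : ∀ s, 0 ≤ s → x s l = x₀ l + ∫ u in (0 : ℝ)..s, v u l := by
    intro s hs
    have h1 := L.intervalIntegral_comp_comm (hv s hs)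
    rw [hx s hs]
    exact congrArg (x₀ l + ·) h1.symm
  have hvel : ∀ᵐ s, 0 < s → v s l ≤ 0 ∧ (0 < x s l → v s l ≤ -κ) := by
    filter_upwards [hae] with s hs hs0
    obtain ⟨hd, w, hw, hvw, -⟩ := hs hs0
    have hpos : 0 < x s l → v s l ≤ -κ := by
      intro hxs
      -- Setting coordinate `l` to zero stays in the box; testing the normal vector there shows `0 ≤
      -- w l`, so the constraint can only add to the decrease.
      have h1 := hw.2 (x s - EuclideanSpace.single l (x s l)) (fun i => by
        by_cases hi : i = l
        · subst hi; simpa using hM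
        · simpa [hi] using hmem s hs0.le i)
      rw [sub_sub_cancel_left, inner_neg_right, EuclideanSpace.inner_single_right] at h1
      simp only [conj_trivial] at h1
      have h2 : 0 ≤ w l := by
        by_contra hneg
        nlinarith
      have h3 := hgrad s hs0.le
      rw [hvw]
      simp only [PiLp.sub_apply, PiLp.neg_apply]
      linarith
    refine ⟨?_, hpos⟩
    rcases (hmem s hs0.le l).1.eq_or_lt with h0 | h0
    · have hdl : HasDerivAt (fun s => x s l) (v s l) s := L.hasFDerivAt.comp_hasDerivAt s hd
      refine (IsLocalMin.hasDerivAt_eq_zero ?_ hdl).le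
      filter_upwards [Ioi_mem_nhds hs0] with r hr
      rw [← h0]
      exact (hmem r (le_of_lt hr) l).1
    · exact (hpos h0).trans (by linarith)
  by_contra hne
  have hpos : 0 < x t l := lt_of_le_of_ne (hmem t ht0 l).1 (Ne.symm hne)
  -- The coordinate never increases, so if it is positive at `t` it was positive before and lost at
  -- least `κ * t`, which exceeds `M`. The extra unit of time makes this strict.
  have hanti : ∀ s, 0 ≤ s → s ≤ t → x t l ≤ x s l := by
    intro s hs hst
    have hsub := intervalIntegral.integral_interval_sub_left (hLv t ht0) (hLv s hs)
    rw [hxl t ht0, hxl s hs]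
    have : 0 ≤ ∫ u in s..t, -v u l := by
      refine intervalIntegral.integral_nonneg_of_ae_restrict hst ?_
      have h0 : ∀ᵐ s : ℝ, s ≠ 0 := by simp [ae_iff, measure_singleton]
      filter_upwards [ae_restrict_of_ae hvel, ae_restrict_of_ae h0,
        ae_restrict_mem measurableSet_Icc] with r h1 h2 h3
      simpa using (h1 (lt_of_le_of_ne (hs.trans h3.1) (Ne.symm h2))).1
    rw [intervalIntegral.integral_neg] at this
    linarith
  have hint : 0 ≤ ∫ u in (0 : ℝ)..t, (-κ - v u l) := by
    refine intervalIntegral.integral_nonneg_of_ae_restrict ht0 ?_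
    have h0 : ∀ᵐ s : ℝ, s ≠ 0 := by simp [ae_iff, measure_singleton]
    filter_upwards [ae_restrict_of_ae hvel, ae_restrict_of_ae h0,
      ae_restrict_mem measurableSet_Icc] with r h1 h2 h3
    have := (h1 (lt_of_le_of_ne h3.1 (Ne.symm h2))).2 (hpos.trans_le (hanti r h3.1 h3.2))
    simpa using this
  rw [intervalIntegral.integral_sub intervalIntegrable_const (hLv t ht0),
    intervalIntegral.integral_const] at hint
  have h1 := hxl t ht0
  have h2 : x₀ l ≤ M := (h.1 l).2
  have h3 : M + κ ≤ κ * t := by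
    calc M + κ = κ * (M / κ + 1) := by field_simp
      _ ≤ κ * t := by gcongr
  simp only [sub_zero, smul_eq_mul] at hint
  linarith

end Flow

end MetricLearning

namespace MetricLearning

open Set Filter Topology
open scoped NNReal ENNReal

/-! ### The kernels as characteristic functions. -/

section Kernel

theorem integrable_exp_neg_mul_abs {a : ℝ} (ha : 0 < a) :
    Integrable fun u : ℝ => Real.exp (-a * |u|) := by
  rw [← integrableOn_univ, ← Iic_union_Ioi (a := (0 : ℝ)), integrableOn_union]
  constructor
  · refine (integrableOn_exp_mul_Iic ha 0).congr_fun (fun u hu => ?_) measurableSet_Iic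
    simp [abs_of_nonpos (mem_Iic.1 hu)]
  · refine (integrableOn_exp_mul_Ioi (neg_lt_zero.2 ha) 0).congr_fun (fun u hu => ?_) measurableSet_Ioi
    simp [abs_of_pos (mem_Ioi.1 hu)]

-- Splitting at `0` leaves two complex exponential integrals. What matters later is that the result
-- is strictly positive and integrable.
open Complex in
theorem fourier_exp_neg_mul_abs {a : ℝ} (ha : 0 < a) (w : ℝ) :
    FourierTransform.fourier (fun u : ℝ => (Real.exp (-a * |u|) : ℂ)) w =
      ((2 * a / (a ^ 2 + (2 * Real.pi * w) ^ 2) : ℝ) : ℂ) := by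
  have hint : Integrable fun u : ℝ =>
      cexp (↑(-2 * Real.pi * u * w) * I) • (Real.exp (-a * |u|) : ℂ) := by
    refine (integrable_exp_neg_mul_abs ha).ofReal.bdd_mul (c := 1)
      (Continuous.aestronglyMeasurable (by fun_prop)) (Eventually.of_forall fun u => ?_)
    rw [Complex.norm_exp_ofReal_mul_I]
  rw [Real.fourier_real_eq_integral_exp_smul,
    ← integral_add_compl (measurableSet_Iic (a := (0:ℝ))) hint, compl_Iic]
  have h1 : ∫ u in Iic (0 : ℝ), cexp (↑(-2 * Real.pi * u * w) * I) • (Real.exp (-a * |u|) : ℂ) =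
      ∫ u in Iic (0 : ℝ), cexp ((a - 2 * Real.pi * w * I) * u) := by
    refine setIntegral_congr_fun measurableSet_Iic fun u hu => ?_
    simp only [abs_of_nonpos (mem_Iic.1 hu), smul_eq_mul]
    push_cast
    rw [← Complex.exp_add]
    congr 1; ring
  have h2 : ∫ u in Ioi (0 : ℝ), cexp (↑(-2 * Real.pi * u * w) * I) • (Real.exp (-a * |u|) : ℂ) =
      ∫ u in Ioi (0 : ℝ), cexp ((-a - 2 * Real.pi * w * I) * u) := by
    refine setIntegral_congr_fun measurableSet_Ioi fun u hu => ?_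
    simp only [abs_of_pos (mem_Ioi.1 hu), smul_eq_mul]
    push_cast
    rw [← Complex.exp_add]
    congr 1; ring
  have hc1 : (a - 2 * Real.pi * w * I : ℂ) ≠ 0 := fun h => by
    have := congrArg re h; simp at this; exact ha.ne' this
  have hc2 : (-a - 2 * Real.pi * w * I : ℂ) ≠ 0 := fun h => by
    have := congrArg re h; simp at this; exact ha.ne' this
  rw [h1, h2, integral_exp_mul_complex_Iic (by simpa using ha),
    integral_exp_mul_complex_Ioi (by simpa using ha)]
  have hc3 : (a ^ 2 + (2 * Real.pi * w) ^ 2 : ℂ) =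
      -((a - 2 * Real.pi * w * I) * (-a - 2 * Real.pi * w * I)) := by
    linear_combination ((2 * Real.pi * w) ^ 2 : ℂ) * I_sq
  push_cast
  rw [hc3]
  simp only [mul_zero, Complex.exp_zero]
  rw [div_add_div _ _ hc1 hc2, div_neg, ← neg_div]
  congr 1
  ring

open Complex in
/-- The characteristic function representation of the Laplace kernel. -/
theorem exists_measure_charFun_laplace {a : ℝ} (ha : 0 < a) :
    ∃ ρ : Measure ℝ, IsFiniteMeasure ρ ∧ ρ.IsOpenPosMeasure ∧
      ∀ u : ℝ, ∫ w, cexp ((w * u : ℝ) * I) ∂ρ = (Real.exp (-(a * |u|)) : ℂ) := by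
  set d : ℝ → ℝ := fun w => 2 * a / (a ^ 2 + (2 * Real.pi * w) ^ 2) with hd
  have hdpos : ∀ w, 0 < d w := fun w => by simp only [hd]; positivity
  have hdcont : Continuous d := by
    refine continuous_const.div (by fun_prop) fun w => ?_
    positivity
  have hdint : Integrable d := by
    have h1 := (integrable_inv_one_add_sq.comp_mul_left' (R := 2 * Real.pi / a)
      (by positivity)).const_mul (2 / a)
    refine h1.congr (Eventually.of_forall fun w => ?_)
    simp only [hd]
    field_simp
  have hF : FourierTransform.fourier (fun u : ℝ => (Real.exp (-a * |u|) : ℂ)) =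
      fun w => (d w : ℂ) := funext (fourier_exp_neg_mul_abs ha)
  have hinv := Continuous.fourierInv_fourier_eq (f := fun u : ℝ => (Real.exp (-a * |u|) : ℂ))
    (by fun_prop) (integrable_exp_neg_mul_abs ha).ofReal (by rw [hF]; exact hdint.ofReal)
  rw [hF] at hinv
  set ρ₀ : Measure ℝ := volume.withDensity fun w => ENNReal.ofReal (d w) with hρ₀
  have hfin : IsFiniteMeasure ρ₀ := isFiniteMeasure_withDensity_ofReal hdint.2
  have hpos : ρ₀.IsOpenPosMeasure := Measure.AbsolutelyContinuous.isOpenPosMeasure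
    (withDensity_absolutelyContinuous' hdcont.measurable.ennreal_ofReal.aemeasurable
      (Eventually.of_forall fun w => by simpa using hdpos w))
  have hmeas : Measurable fun w : ℝ => 2 * Real.pi * w := by fun_prop
  -- Rescaling the frequency absorbs the `2 * π` in the exponent of the Fourier transform.
  refine ⟨ρ₀.map fun w => 2 * Real.pi * w, Measure.isFiniteMeasure_map _ _,
    Continuous.isOpenPosMeasure_map (by fun_prop)
      (mul_left_surjective₀ (by positivity)), fun u => ?_⟩
  rw [integral_map hmeas.aemeasurable (by fun_prop), hρ₀]
  have h2 := integral_withDensity_eq_integral_toReal_smul (μ := volume)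
    (f := fun w => ENNReal.ofReal (d w)) hdcont.measurable.ennreal_ofReal
    (Eventually.of_forall fun w => ENNReal.ofReal_lt_top)
    fun w => cexp ((2 * Real.pi * w * u : ℝ) * I)
  rw [h2]
  have h3 := congrFun hinv u
  rw [Real.fourierInv_eq'] at h3
  rw [neg_mul] at h3
  rw [← h3]
  refine integral_congr_ae (Eventually.of_forall fun w => ?_)
  simp only [ENNReal.toReal_ofReal (hdpos w).le, real_smul, smul_eq_mul, conj_trivial,
    RCLike.inner_apply]
  rw [mul_comm]
  congr 4
  ring

open Complex in
/-- For `q ∈ {1, 2}` the kernel `exp (-a |u|^q)` is the characteristic function of a finite measure,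
which has full support when `a > 0`. -/
theorem exists_measure_charFun_exp_neg {q : ℕ} (hq : q = 1 ∨ q = 2) {a : ℝ} (ha : 0 ≤ a) :
    ∃ ρ : Measure ℝ, IsFiniteMeasure ρ ∧ (0 < a → ρ.IsOpenPosMeasure) ∧
      ∀ u : ℝ, ∫ w, cexp ((w * u : ℝ) * I) ∂ρ = (Real.exp (-(a * |u| ^ q)) : ℂ) := by
  rcases ha.eq_or_lt with rfl | ha
  · exact ⟨Measure.dirac 0, inferInstance, fun h => absurd h (lt_irrefl _), fun u => by simp⟩
  rcases hq with rfl | rfl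
  · obtain ⟨ρ, h1, h2, h3⟩ := exists_measure_charFun_laplace ha
    exact ⟨ρ, h1, fun _ => h2, fun u => by simpa using h3 u⟩
  -- A centered Gaussian of variance `2 * a` has characteristic function `exp (-a * u ^ 2)`.
  · have h2a : (2 * a).toNNReal ≠ 0 := by simpa using ha
    refine ⟨gaussianReal 0 (2 * a).toNNReal, inferInstance, fun _ =>
      (gaussianReal_absolutelyContinuous' 0 h2a).isOpenPosMeasure, fun u => ?_⟩
    have h := charFun_gaussianReal (μ := 0) (v := (2 * a).toNNReal) u
    rw [charFun_apply_real, Real.coe_toNNReal _ (by positivity)] at h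
    push_cast
    convert h using 2
    · ext w; congr 2; ring
    · simp only [← ofReal_pow, sq_abs]
      push_cast
      ring

end Kernel
end MetricLearning

namespace MetricLearning

open Set Filter Topology
open scoped NNReal ENNReal

/-! ### Positivity of the kernel form. -/

section Form

/-- The quadratic form `E[Y Y' exp (-∑ i, a_i |X_i - X_i'|^q)]`. -/
noncomputable def kernelForm {p : ℕ} (q : ℕ) (Q : Measure (Data p)) (a : Fin p → ℝ) : ℝ :=
  ∫ w : Data p × Data p, w.1.2 * w.2.2 * Real.exp (-∑ i, a i * |w.1.1 i - w.2.1 i| ^ q) ∂(Q.prod Q)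

/-- The characteristic function of the signed measure `E[Y; X ∈ ·]`. -/
noncomputable def responseCharFun {p : ℕ} (Q : Measure (Data p)) (ω : Fin p → ℝ) : ℂ :=
  ∫ z, (z.2 : ℂ) * Complex.exp ((∑ i, ω i * z.1 i : ℝ) * Complex.I) ∂Q

variable {p q : ℕ} {Q : Measure (Data p)}

theorem continuous_responseCharFun (hY : Integrable (fun z : Data p => z.2) Q) :
    Continuous (responseCharFun Q) := by
  refine continuous_of_dominated (bound := fun z => |z.2|) (fun ω => ?_) (fun ω => ?_) hY.abs ?_
  · exact Continuous.aestronglyMeasurable (by fun_prop)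
  · refine Eventually.of_forall fun z => ?_
    rw [norm_mul, Complex.norm_exp_ofReal_mul_I, mul_one, Complex.norm_real, Real.norm_eq_abs]
  · exact Eventually.of_forall fun z => by fun_prop

-- The product kernel is the characteristic function of `Measure.pi ρ`. Fubini moves the frequency
-- integral outside, and at each frequency the two independent copies give a number times its
-- conjugate.
open Complex in
theorem kernelForm_eq_integral [IsFiniteMeasure Q] (hY : Integrable (fun z : Data p => z.2) Q)
    {a : Fin p → ℝ} (ρ : Fin p → Measure ℝ) [∀ i, IsFiniteMeasure (ρ i)]
    (hρ : ∀ i (u : ℝ), ∫ w, cexp ((w * u : ℝ) * I) ∂ρ i = (Real.exp (-(a i * |u| ^ q)) : ℂ)) :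
    kernelForm q Q a = ∫ ω, ‖responseCharFun Q ω‖ ^ 2 ∂Measure.pi ρ := by
  have hexp : ∀ u : Fin p → ℝ, ∫ ω, cexp ((∑ i, ω i * u i : ℝ) * I) ∂Measure.pi ρ =
      (Real.exp (-∑ i, a i * |u i| ^ q) : ℂ) := by
    intro u
    have h := integral_fintype_prod_eq_prod (μ := ρ) fun i (w : ℝ) => cexp ((w * u i : ℝ) * I)
    simp_rw [hρ] at h
    rw [← Finset.sum_neg_distrib, Real.exp_sum, ofReal_prod, ← h]
    refine integral_congr_ae (Eventually.of_forall fun ω => ?_)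
    simp only
    rw [← Complex.exp_sum, ofReal_sum, Finset.sum_mul]
  have hYY : Integrable (fun w : Data p × Data p => (w.1.2 : ℂ) * w.2.2) (Q.prod Q) :=
    hY.ofReal.mul_prod hY.ofReal
  have hint : Integrable (Function.uncurry fun (w : Data p × Data p) (ω : Fin p → ℝ) =>
      ((w.1.2 : ℂ) * w.2.2) * cexp ((∑ i, ω i * (w.1.1 i - w.2.1 i) : ℝ) * I))
      ((Q.prod Q).prod (Measure.pi ρ)) := by
    have h1 := hYY.mul_prod (integrable_const (μ := Measure.pi ρ) (1 : ℂ))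
    have h2 := h1.bdd_mul (c := 1)
      (f := fun x : (Data p × Data p) × (Fin p → ℝ) =>
        cexp ((∑ i, x.2 i * (x.1.1.1 i - x.1.2.1 i) : ℝ) * I))
      (Continuous.aestronglyMeasurable (by fun_prop))
      (Eventually.of_forall fun x => by rw [Complex.norm_exp_ofReal_mul_I])
    refine h2.congr (Eventually.of_forall fun x => ?_)
    simp only [Function.uncurry, mul_one]
    ring
  have hswap := integral_integral_swap hint
  have hleft : ∀ w : Data p × Data p, ∫ ω, ((w.1.2 : ℂ) * w.2.2) *
      cexp ((∑ i, ω i * (w.1.1 i - w.2.1 i) : ℝ) * I) ∂Measure.pi ρ =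
      ((w.1.2 * w.2.2 * Real.exp (-∑ i, a i * |w.1.1 i - w.2.1 i| ^ q) : ℝ) : ℂ) := by
    intro w
    rw [integral_const_mul, hexp fun i => w.1.1 i - w.2.1 i]
    push_cast; ring
  have hright : ∀ ω : Fin p → ℝ, ∫ w : Data p × Data p, ((w.1.2 : ℂ) * w.2.2) *
      cexp ((∑ i, ω i * (w.1.1 i - w.2.1 i) : ℝ) * I) ∂(Q.prod Q) =
      ((‖responseCharFun Q ω‖ ^ 2 : ℝ) : ℂ) := by
    intro ω
    have h1 := integral_prod_mul (μ := Q) (ν := Q)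
      (fun z : Data p => (z.2 : ℂ) * cexp ((∑ i, ω i * z.1 i : ℝ) * I))
      (fun z : Data p => (starRingEnd ℂ) ((z.2 : ℂ) * cexp ((∑ i, ω i * z.1 i : ℝ) * I)))
    rw [integral_conj, ← responseCharFun, mul_conj, normSq_eq_norm_sq] at h1
    rw [← h1]
    refine integral_congr_ae (Eventually.of_forall fun w => ?_)
    simp only
    rw [map_mul, conj_ofReal, ← Complex.exp_conj, map_mul, conj_ofReal, conj_I,
      mul_mul_mul_comm, ← Complex.exp_add]
    congr 2
    simp only [mul_sub, Finset.sum_sub_distrib]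
    push_cast; ring
  simp_rw [hleft, hright] at hswap
  rw [integral_complex_ofReal, integral_complex_ofReal] at hswap
  exact_mod_cast hswap

/-- The kernel form is positive semidefinite. -/
theorem kernelForm_nonneg [IsFiniteMeasure Q] (hq : q = 1 ∨ q = 2)
    (hY : Integrable (fun z : Data p => z.2) Q) {a : Fin p → ℝ} (ha : ∀ i, 0 ≤ a i) :
    0 ≤ kernelForm q Q a := by
  choose ρ h1 h2 h3 using fun i => exists_measure_charFun_exp_neg hq (ha i)
  rw [kernelForm_eq_integral hY ρ h3]
  positivity

/-- If the characteristic function of `E[Y; X ∈ ·]` vanishes, then `E[Y | X] = 0`. -/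
theorem condExp_eq_zero_of_responseCharFun [IsFiniteMeasure Q]
    (hY : Integrable (fun z : Data p => z.2) Q) (h : ∀ ω, responseCharFun Q ω = 0) :
    Q[fun z => z.2 | MeasurableSpace.comap (fun z : Data p => z.1) inferInstance] =ᵐ[Q] 0 := by
  -- The signed measure `E[Y; X ∈ ·]` is handled as a difference of two finite measures with
  -- densities `Y⁺` and `Y⁻`. Equal characteristic functions make them equal.
  set ν : (ℝ → ℝ≥0) → Measure (Fin p → ℝ) := fun r =>
    (Q.withDensity fun z => (r z.2 : ℝ≥0∞)).map fun z => z.1 with hν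
  set rp : ℝ → ℝ≥0 := fun y => y.toNNReal
  set rn : ℝ → ℝ≥0 := fun y => (-y).toNNReal
  have hrp : Measurable rp := measurable_real_toNNReal
  have hrn : Measurable rn := measurable_real_toNNReal.comp measurable_neg
  have hip : Integrable (fun z : Data p => (rp z.2 : ℝ)) Q := hY.pos_part
  have hin : Integrable (fun z : Data p => (rn z.2 : ℝ)) Q := hY.neg_part
  have hdiff : ∀ y : ℝ, (rp y : ℝ) - rn y = y := fun y => by
    simp only [rp, rn, Real.coe_toNNReal', max_zero_sub_max_neg_zero_eq_self]
  have hfin : ∀ r : ℝ → ℝ≥0, Integrable (fun z : Data p => (r z.2 : ℝ)) Q →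
      IsFiniteMeasure (ν r) := by
    intro r hr
    have := isFiniteMeasure_withDensity_ofReal hr.2
    simp only [ENNReal.ofReal_coe_nnreal] at this
    exact Measure.isFiniteMeasure_map _ _
  have := hfin rp hip
  have := hfin rn hin
  have hchar : ∀ r : ℝ → ℝ≥0, Measurable r → ∀ L : StrongDual ℝ (Fin p → ℝ), charFunDual (ν r) L =
      ∫ z : Data p, ((r z.2 : ℝ) : ℂ) * Complex.exp ((L z.1 : ℝ) * Complex.I) ∂Q := by
    intro r hr L
    rw [charFunDual_apply, integral_map (by fun_prop)
      (Continuous.aestronglyMeasurable (by fun_prop)),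
      integral_withDensity_eq_integral_smul (f := fun z : Data p => r z.2)
        (hr.comp measurable_snd)]
    rfl
  have hint : ∀ r : ℝ → ℝ≥0, Integrable (fun z : Data p => (r z.2 : ℝ)) Q →
      ∀ L : StrongDual ℝ (Fin p → ℝ),
      Integrable (fun z : Data p => ((r z.2 : ℝ) : ℂ) * Complex.exp ((L z.1 : ℝ) * Complex.I)) Q :=
    fun r hr L => hr.ofReal.mul_bdd (c := 1) (Continuous.aestronglyMeasurable (by fun_prop))
      (Eventually.of_forall fun z => by rw [Complex.norm_exp_ofReal_mul_I])
  have heq : ν rp = ν rn := by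
    refine Measure.ext_of_charFunDual (funext fun L => ?_)
    rw [hchar rp hrp, hchar rn hrn, ← sub_eq_zero, ← integral_sub (hint rp hip L) (hint rn hin L),
      ← h fun i => L (Pi.single i 1)]
    refine integral_congr_ae (Eventually.of_forall fun z => ?_)
    have hL : L z.1 = ∑ i, L (Pi.single i 1) * z.1 i := by
      conv_lhs => rw [← Finset.univ_sum_single z.1, map_sum]
      refine Finset.sum_congr rfl fun i _ => ?_
      rw [mul_comm, ← smul_eq_mul, ← map_smul, ← Pi.single_smul, smul_eq_mul, mul_one]
    simp only
    rw [← sub_mul, ← Complex.ofReal_sub, hdiff, hL]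
  have hm : MeasurableSpace.comap (fun z : Data p => z.1) inferInstance ≤
      (inferInstance : MeasurableSpace (Data p)) := measurable_fst.comap_le
  refine (ae_eq_condExp_of_forall_setIntegral_eq hm hY (fun s _ _ => integrableOn_zero)
    (fun s hs _ => ?_) aestronglyMeasurable_zero).symm
  obtain ⟨s, hs, rfl⟩ := hs
  have hset : ∀ r : ℝ → ℝ≥0, Measurable r → Integrable (fun z : Data p => (r z.2 : ℝ)) Q →
      ∫ z in (fun z : Data p => z.1) ⁻¹' s, (r z.2 : ℝ) ∂Q = (ν r).real s := by
    intro r hr hir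
    rw [Measure.real, hν, Measure.map_apply measurable_fst hs,
      withDensity_apply _ (measurable_fst hs),
      integral_eq_lintegral_of_nonneg_ae (Eventually.of_forall fun z => NNReal.coe_nonneg _)
        hir.1.restrict]
    simp
  have h1 := hset rp hrp hip
  have h2 := hset rn hrn hin
  rw [heq, ← h2, ← sub_eq_zero, ← integral_sub hip.integrableOn hin.integrableOn] at h1
  simp only [hdiff] at h1
  rw [h1]
  simp

/-- The kernel form is positive at full-support weights unless `E[Y | X] = 0`. -/
theorem kernelForm_pos [IsFiniteMeasure Q] (hq : q = 1 ∨ q = 2)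
    (hY : Integrable (fun z : Data p => z.2) Q)
    (hne : ¬ Q[fun z => z.2 | MeasurableSpace.comap (fun z : Data p => z.1) inferInstance] =ᵐ[Q] 0)
    {a : Fin p → ℝ} (ha : ∀ i, 0 < a i) : 0 < kernelForm q Q a := by
  choose ρ h1 h2 h3 using fun i => exists_measure_charFun_exp_neg hq (ha i).le
  have h4 : ∀ i, (ρ i).IsOpenPosMeasure := fun i => h2 i (ha i)
  refine (kernelForm_nonneg hq hY fun i => (ha i).le).lt_of_ne fun h0 => hne ?_
  rw [kernelForm_eq_integral hY ρ h3, eq_comm] at h0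
  have hcont := continuous_responseCharFun hY
  have hbdd : ∀ ω, ‖responseCharFun Q ω‖ ≤ ∫ z, |z.2| ∂Q := by
    intro ω
    refine (norm_integral_le_integral_norm _).trans (le_of_eq ?_)
    refine integral_congr_ae (Eventually.of_forall fun z => ?_)
    simp only
    rw [norm_mul, Complex.norm_exp_ofReal_mul_I, mul_one, Complex.norm_real, Real.norm_eq_abs]
  have hint : Integrable (fun ω => ‖responseCharFun Q ω‖ ^ 2) (Measure.pi ρ) :=
    Integrable.of_bound (C := (∫ z, |z.2| ∂Q) ^ 2)
      (hcont.norm.pow 2).aestronglyMeasurable (Eventually.of_forall fun ω => by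
      rw [norm_pow, norm_norm]
      exact pow_le_pow_left₀ (norm_nonneg _) (hbdd ω) 2)
  rw [integral_eq_zero_iff_of_nonneg (fun ω => sq_nonneg _) hint] at h0
  -- Continuity and full support of the frequency measure upgrade almost everywhere vanishing to
  -- vanishing everywhere.
  have h5 := (Continuous.ae_eq_iff_eq (Measure.pi ρ) (hcont.norm.pow 2) continuous_zero).1 h0
  refine condExp_eq_zero_of_responseCharFun hY fun ω => ?_
  simpa using congrFun h5 ω

end Form
end MetricLearning

namespace MetricLearning

open Set Filter Topology
open scoped NNReal ENNReal

/-! ### Integrability on compact supports. -/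

section Integrability

theorem Continuous.integrable_of_ae_mem_compact {X : Type*} [TopologicalSpace X]
    [SecondCountableTopology X] [MeasurableSpace X] [OpensMeasurableSpace X] {μ : Measure X}
    [IsFiniteMeasure μ] {f : X → ℝ} (hf : Continuous f) {K : Set X} (hK : IsCompact K)
    (h : ∀ᵐ x ∂μ, x ∈ K) : Integrable f μ := by
  obtain ⟨C, hC⟩ := hK.exists_bound_of_continuousOn hf.continuousOn
  exact Integrable.of_bound hf.aestronglyMeasurable C (h.mono hC)

theorem ae_mem_prod {X Y : Type*} [MeasurableSpace X] [MeasurableSpace Y] {μ : Measure X}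
    {ν : Measure Y} [SFinite ν] {s : Set X} {t : Set Y} (hs : ∀ᵐ x ∂μ, x ∈ s)
    (ht : ∀ᵐ y ∂ν, y ∈ t) : ∀ᵐ w ∂μ.prod ν, w ∈ s ×ˢ t := by
  filter_upwards [Measure.quasiMeasurePreserving_fst.ae hs,
    Measure.quasiMeasurePreserving_snd.ae ht] with w h1 h2 using ⟨h1, h2⟩

end Integrability

/-! ### Factorization under signal and noise independence. -/

section Separation

variable {p : ℕ} {Q : Measure (Data p)}

theorem continuous_subFeatures (T : Finset (Fin p)) : Continuous (subFeatures T) := by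
  unfold subFeatures; fun_prop

theorem measurable_subFeatures (T : Finset (Fin p)) : Measurable (subFeatures T) :=
  (continuous_subFeatures T).measurable

/-- Under separation, the response correlates with a product of a signal and a noise function
only through the signal function. -/
theorem SeparatesSignal.integral_mul_mul [IsProbabilityMeasure Q] {T : Finset (Fin p)}
    (h : SeparatesSignal Q T) (hY : Integrable (fun z : Data p => z.2) Q)
    {φ : (T → ℝ) → ℝ} {ψ : ((Tᶜ : Finset (Fin p)) → ℝ) → ℝ} (hφ : Measurable φ) (hψ : Measurable ψ)
    {C D : ℝ} (hC : ∀ᵐ z ∂Q, |φ (subFeatures T z)| ≤ C)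
    (hD : ∀ᵐ z ∂Q, |ψ (subFeatures Tᶜ z)| ≤ D) :
    ∫ z, z.2 * (φ (subFeatures T z) * ψ (subFeatures Tᶜ z)) ∂Q =
      (∫ z, z.2 * φ (subFeatures T z) ∂Q) * ∫ z, ψ (subFeatures Tᶜ z) ∂Q := by
  have hm : MeasurableSpace.comap (fun z : Data p => z.1) inferInstance ≤
      (Prod.instMeasurableSpace : MeasurableSpace (Data p)) := measurable_fst.comap_le
  have hmT : MeasurableSpace.comap (subFeatures T) inferInstance ≤
      (Prod.instMeasurableSpace : MeasurableSpace (Data p)) := (measurable_subFeatures T).comap_le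
  set m : MeasurableSpace (Data p) :=
    MeasurableSpace.comap (fun z : Data p => z.1) inferInstance with hm_def
  set mT : MeasurableSpace (Data p) :=
    MeasurableSpace.comap (subFeatures T) inferInstance with hmT_def
  have hfst : Measurable[m] fun z : Data p => z.1 := comap_measurable _
  have hsubm : ∀ T' : Finset (Fin p), Measurable[m] (subFeatures (p := p) T') := fun T' =>
    (measurable_pi_lambda _ fun i : T' => measurable_pi_apply (i : Fin p)).comp hfst
  have hsubT : Measurable[mT] (subFeatures (p := p) T) := comap_measurable _
  have hφm : StronglyMeasurable[mT] fun z : Data p => φ (subFeatures T z) :=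
    (hφ.comp hsubT).stronglyMeasurable
  have hprodm : StronglyMeasurable[m] fun z : Data p =>
      φ (subFeatures T z) * ψ (subFeatures Tᶜ z) :=
    ((hφ.comp (hsubm T)).mul (hψ.comp (hsubm Tᶜ))).stronglyMeasurable
  have hint1 : Integrable (fun z : Data p => z.2 * φ (subFeatures T z)) Q :=
    hY.mul_bdd (hφm.mono hmT).aestronglyMeasurable hC
  have hint2 : Integrable (fun z : Data p => z.2 * (φ (subFeatures T z) * ψ (subFeatures Tᶜ z))) Q := by
    refine hY.mul_bdd (c := C * D) (hprodm.mono hm).aestronglyMeasurable ?_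
    filter_upwards [hC, hD] with z h1 h2
    rw [norm_mul]
    exact mul_le_mul h1 h2 (norm_nonneg _) ((abs_nonneg _).trans h1)
  have e1 : ∫ z, z.2 * (φ (subFeatures T z) * ψ (subFeatures Tᶜ z)) ∂Q =
      ∫ z, (Q[fun z => z.2 | mT] z * φ (subFeatures T z)) * ψ (subFeatures Tᶜ z) ∂Q := by
    rw [← integral_condExp hm]
    refine integral_congr_ae ?_
    filter_upwards [condExp_mul_of_stronglyMeasurable_right hprodm hint2 hY, h.1] with z h1 h2
    refine h1.trans ?_
    rw [Pi.mul_apply, h2, mul_assoc]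
  have e2 : ∫ z, z.2 * φ (subFeatures T z) ∂Q =
      ∫ z, Q[fun z => z.2 | mT] z * φ (subFeatures T z) ∂Q := by
    rw [← integral_condExp hmT]
    exact integral_congr_ae (condExp_mul_of_stronglyMeasurable_right hφm hint1 hY)
  -- After conditioning, the response is a function of `X_T` alone, so independence from `X_{T^c}`
  -- applies although `Y` itself need not be independent of it.
  obtain ⟨g, hg, hgeq⟩ := (stronglyMeasurable_condExp (μ := Q) (m := mT)
    (f := fun z : Data p => z.2)).exists_eq_measurable_comp
  have hind := h.2.comp (hg.measurable.mul hφ) hψ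
  rw [e1, e2, hgeq]
  exact hind.integral_fun_mul_eq_mul_integral
    (((hg.measurable.mul hφ).comp (measurable_subFeatures T)).aestronglyMeasurable)
    ((hψ.comp (measurable_subFeatures Tᶜ)).aestronglyMeasurable)

/-- Two-sample version of `SeparatesSignal.integral_mul_mul`. -/
theorem SeparatesSignal.integral_prod_factor [IsProbabilityMeasure Q] {T : Finset (Fin p)}
    (h : SeparatesSignal Q T) {R : ℝ} (hR : ∀ᵐ z ∂Q, z ∈ Metric.closedBall (0 : Data p) R)
    {A : (T → ℝ) × (T → ℝ) → ℝ}
    {B : ((Tᶜ : Finset (Fin p)) → ℝ) × ((Tᶜ : Finset (Fin p)) → ℝ) → ℝ}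
    (hA : Continuous A) (hB : Continuous B) :
    ∫ w : Data p × Data p, w.1.2 * w.2.2 * (A (subFeatures T w.1, subFeatures T w.2) *
        B (subFeatures Tᶜ w.1, subFeatures Tᶜ w.2)) ∂(Q.prod Q) =
      (∫ w : Data p × Data p, w.1.2 * w.2.2 * A (subFeatures T w.1, subFeatures T w.2) ∂(Q.prod Q)) *
      ∫ w : Data p × Data p, B (subFeatures Tᶜ w.1, subFeatures Tᶜ w.2) ∂(Q.prod Q) := by
  have hK := isCompact_closedBall (0 : Data p) R
  have hsT := continuous_subFeatures (p := p) T
  have hsTc := continuous_subFeatures (p := p) Tᶜ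
  have hcA : Continuous fun w : Data p × Data p => A (subFeatures T w.1, subFeatures T w.2) := by
    fun_prop
  have hcB : Continuous fun w : Data p × Data p => B (subFeatures Tᶜ w.1, subFeatures Tᶜ w.2) := by
    fun_prop
  have hYi : Integrable (fun z : Data p => z.2) Q :=
    Continuous.integrable_of_ae_mem_compact continuous_snd hK hR
  have hpr := ae_mem_prod hR hR
  obtain ⟨CA, hCA⟩ := (hK.prod hK).exists_bound_of_continuousOn hcA.continuousOn
  obtain ⟨CB, hCB⟩ := (hK.prod hK).exists_bound_of_continuousOn hcB.continuousOn
  have int : ∀ {f : Data p × Data p → ℝ}, Continuous f → Integrable f (Q.prod Q) := fun hf =>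
    Continuous.integrable_of_ae_mem_compact hf (hK.prod hK) hpr
  rw [integral_prod _ (int (by fun_prop)), integral_prod _ (int (by fun_prop)),
    integral_prod _ (int (by fun_prop))]
  set α : (T → ℝ) → ℝ := fun u => ∫ z, z.2 * A (u, subFeatures T z) ∂Q with hα
  set β : ((Tᶜ : Finset (Fin p)) → ℝ) → ℝ := fun v => ∫ z, B (v, subFeatures Tᶜ z) ∂Q with hβ
  have hαm : Measurable α := by
    refine (StronglyMeasurable.integral_prod_right' (f := fun x : (T → ℝ) × Data p =>
      x.2.2 * A (x.1, subFeatures T x.2)) ?_).measurable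
    exact Continuous.stronglyMeasurable (by fun_prop)
  have hβm : Measurable β := by
    refine (StronglyMeasurable.integral_prod_right'
      (f := fun x : ((Tᶜ : Finset (Fin p)) → ℝ) × Data p => B (x.1, subFeatures Tᶜ x.2)) ?_).measurable
    exact Continuous.stronglyMeasurable (by fun_prop)
  -- The one-sample factorization is used twice: here in the second sample with the first frozen,
  -- then in the first.
  have hinner : ∀ᵐ z ∂Q, ∫ z', z.2 * z'.2 * (A (subFeatures T z, subFeatures T z') *
      B (subFeatures Tᶜ z, subFeatures Tᶜ z')) ∂Q =
      z.2 * (α (subFeatures T z) * β (subFeatures Tᶜ z)) := by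
    filter_upwards [hR] with z hz
    have h1 := h.integral_mul_mul hYi (φ := fun u => A (subFeatures T z, u))
      (ψ := fun v => B (subFeatures Tᶜ z, v)) (C := CA) (D := CB)
      (Continuous.measurable (by fun_prop)) (Continuous.measurable (by fun_prop))
      (hR.mono fun z' hz' => hCA (z, z') ⟨hz, hz'⟩) (hR.mono fun z' hz' => hCB (z, z') ⟨hz, hz'⟩)
    rw [hα, hβ, ← h1, ← integral_const_mul]
    refine integral_congr_ae (Eventually.of_forall fun z' => ?_)
    simp only
    ring
  rw [integral_congr_ae hinner, h.integral_mul_mul hYi (C := R * CA) (D := CB) hαm hβm]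
  · congr 1
    refine integral_congr_ae (Eventually.of_forall fun z => ?_)
    simp only [hα, ← integral_const_mul, mul_assoc]
  · filter_upwards [hR] with z hz
    have := norm_integral_le_of_norm_le_const (μ := Q) (C := R * CA)
      (f := fun z' => z'.2 * A (subFeatures T z, subFeatures T z')) (hR.mono fun z' hz' => by
        rw [norm_mul]
        have h2 : ‖z'.2‖ ≤ R := (norm_snd_le z').trans (by simpa using hz')
        exact mul_le_mul h2 (hCA (z, z') ⟨hz, hz'⟩) (norm_nonneg _) ((norm_nonneg _).trans h2))
    simpa using this
  · filter_upwards [hR] with z hz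
    have := norm_integral_le_of_norm_le_const (μ := Q) (C := CB)
      (f := fun z' => B (subFeatures Tᶜ z, subFeatures Tᶜ z')) (hR.mono fun z' hz' =>
        hCB (z, z') ⟨hz, hz'⟩)
    simpa using this

end Separation
end MetricLearning

namespace MetricLearning

open Set Filter Topology
open scoped NNReal ENNReal

/-! ### The population objective and its noise derivatives. -/

section Population

variable {p q : ℕ} {Q : Measure (Data p)} {μ : Measure ℝ}

theorem KernelAssumption.exists_Icc (hμ : KernelAssumption μ) :
    ∃ m > 0, ∃ m', ∀ᵐ t ∂μ, t ∈ Icc m m' := by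
  refine ⟨sInf μ.support, hμ.inf_support_pos, sSup μ.support, ?_⟩
  -- `sInf` of a set unbounded below is `0`, so a positive value already yields a lower bound.
  have hbdd : BddBelow μ.support := by
    by_contra h
    have := hμ.inf_support_pos
    rw [Real.sInf_of_not_bddBelow h] at this
    exact lt_irrefl _ this
  filter_upwards [Measure.support_mem_ae (μ := μ)] with t ht using
    ⟨csInf_le hbdd ht, le_csSup hμ.bddAbove_support ht⟩

theorem KernelAssumption.ne_zero (hμ : KernelAssumption μ) : μ ≠ 0 := by
  rintro rfl
  have := hμ.inf_support_pos
  simp at this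

theorem DataAssumption.exists_closedBall (hQ : DataAssumption Q) :
    ∃ R, 0 ≤ R ∧ ∀ᵐ z ∂Q, z ∈ Metric.closedBall (0 : Data p) R := by
  obtain ⟨MX, hX⟩ := hQ.bounded_features
  obtain ⟨MY, hY⟩ := hQ.bounded_response
  refine ⟨max 0 (max MX MY), le_max_left _ _, ?_⟩
  filter_upwards [hX, hY] with z h1 h2
  rw [mem_closedBall_zero_iff, Prod.norm_def]
  exact max_le (h1.trans (le_max_of_le_right (le_max_left _ _)))
    (h2.trans (le_max_of_le_right (le_max_right _ _)))

/-- The formula for the partial derivatives of the objective. -/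
noncomputable def mlPartial (μ : Measure ℝ) (q : ℕ) (Q : Measure (Data p))
    (β : EuclideanSpace ℝ (Fin p)) (l : Fin p) : ℝ :=
  ∫ w : Data p × Data p, w.1.2 * w.2.2 *
    ((∫ t, t * Real.exp (-t * weightedNormPow q β (w.1.1 - w.2.1)) ∂μ) *
      |w.1.1 l - w.2.1 l| ^ q) ∂(Q.prod Q)

theorem neg_mul_weightedNormPow (t : ℝ) (β : EuclideanSpace ℝ (Fin p)) (u v : Fin p → ℝ) :
    -t * weightedNormPow q β (u - v) = -∑ i, t * β i * |u i - v i| ^ q := by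
  simp [weightedNormPow, Finset.mul_sum, mul_assoc]

/-- At zero weights the kernel is constant and the integral is a multiple of `E[Y]²`. This is the
reference value that keeps the flow away from the origin. -/
theorem mlObjective_zero [IsProbabilityMeasure Q] (hQ : DataAssumption Q) : mlObjective μ q Q 0 = 0 := by
  have h : ∀ w : Data p × Data p, w.1.2 * w.2.2 *
      kernelProfile μ (weightedNormPow q 0 (w.1.1 - w.2.1)) =
      w.1.2 * w.2.2 * kernelProfile μ 0 := by
    intro w; simp [weightedNormPow]
  rw [mlObjective]
  simp only [h]
  rw [integral_mul_const, integral_prod_mul (fun z : Data p => z.2) (fun z : Data p => z.2),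
    hQ.centered]
  simp

variable [IsProbabilityMeasure Q] [IsFiniteMeasure μ] {R m m' : ℝ}

theorem integrable_prod_prod (hR : ∀ᵐ z ∂Q, z ∈ Metric.closedBall (0 : Data p) R)
    (hm : ∀ᵐ t ∂μ, t ∈ Icc m m') {f : (Data p × Data p) × ℝ → ℝ} (hf : Continuous f) :
    Integrable f ((Q.prod Q).prod μ) :=
  Continuous.integrable_of_ae_mem_compact hf
    (((isCompact_closedBall _ _).prod (isCompact_closedBall _ _)).prod isCompact_Icc)
    (ae_mem_prod (ae_mem_prod hR hR) hm)

theorem integrable_kernelForm (hR : ∀ᵐ z ∂Q, z ∈ Metric.closedBall (0 : Data p) R)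
    (hm : ∀ᵐ t ∂μ, t ∈ Icc m m') (β : EuclideanSpace ℝ (Fin p)) :
    Integrable (fun t => kernelForm q Q fun i => t * β i) μ :=
  (integrable_prod_prod (f := fun x => x.1.1.2 * x.1.2.2 *
    Real.exp (-∑ i, x.2 * β i * |x.1.1.1 i - x.1.2.1 i| ^ q)) hR hm (by fun_prop)).integral_prod_right

/-- The objective is an average of kernel forms. -/
theorem mlObjective_eq (hR : ∀ᵐ z ∂Q, z ∈ Metric.closedBall (0 : Data p) R)
    (hm : ∀ᵐ t ∂μ, t ∈ Icc m m') (β : EuclideanSpace ℝ (Fin p)) :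
    mlObjective μ q Q β = -∫ t, kernelForm q Q (fun i => t * β i) ∂μ := by
  have h := integral_integral_swap (f := fun (w : Data p × Data p) (t : ℝ) => w.1.2 * w.2.2 *
    Real.exp (-∑ i, t * β i * |w.1.1 i - w.2.1 i| ^ q)) (μ := Q.prod Q) (ν := μ)
    (integrable_prod_prod hR hm (by simp only [Function.uncurry_def]; fun_prop))
  rw [mlObjective]
  congr 1
  refine Eq.trans ?_ h
  simp only [kernelProfile, ← integral_const_mul, neg_mul_weightedNormPow]

theorem mlPartial_eq (hR : ∀ᵐ z ∂Q, z ∈ Metric.closedBall (0 : Data p) R)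
    (hm : ∀ᵐ t ∂μ, t ∈ Icc m m') (β : EuclideanSpace ℝ (Fin p)) (l : Fin p) :
    Integrable (fun t => t * ∫ w : Data p × Data p, w.1.2 * w.2.2 *
      (Real.exp (-∑ i, t * β i * |w.1.1 i - w.2.1 i| ^ q) * |w.1.1 l - w.2.1 l| ^ q)
        ∂(Q.prod Q)) μ ∧
    mlPartial μ q Q β l = ∫ t, t * ∫ w : Data p × Data p, w.1.2 * w.2.2 *
      (Real.exp (-∑ i, t * β i * |w.1.1 i - w.2.1 i| ^ q) * |w.1.1 l - w.2.1 l| ^ q)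
        ∂(Q.prod Q) ∂μ := by
  have hint := integrable_prod_prod (Q := Q) (μ := μ) (f := Function.uncurry
    fun (w : Data p × Data p) (t : ℝ) => t * (w.1.2 * w.2.2 *
    (Real.exp (-∑ i, t * β i * |w.1.1 i - w.2.1 i| ^ q) * |w.1.1 l - w.2.1 l| ^ q))) hR hm
    (by simp only [Function.uncurry_def]; fun_prop)
  constructor
  · simpa only [Function.uncurry_def, integral_const_mul] using hint.integral_prod_right
  · have h := integral_integral_swap hint
    simp only [integral_const_mul] at h
    rw [← h, mlPartial]
    refine integral_congr_ae (Eventually.of_forall fun w => ?_)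
    simp only [neg_mul_weightedNormPow]
    rw [← integral_mul_const, ← integral_const_mul]
    refine integral_congr_ae (Eventually.of_forall fun t => ?_)
    simp only
    ring

/-- At weights `a ≥ 0`, the form weighted with a noise coordinate dominates the plain form. -/
theorem SeparatesSignal.kernelForm_le (hq : q = 1 ∨ q = 2)
    (hR : ∀ᵐ z ∂Q, z ∈ Metric.closedBall (0 : Data p) R)
    {S : Finset (Fin p)} (hS : SeparatesSignal Q S) {l : Fin p} (hl : l ∉ S) {a : Fin p → ℝ}
    (ha : ∀ i, 0 ≤ a i) {b : ℝ} (hb : ∀ i, a i ≤ b) :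
    (Real.exp (-(p * (b * (2 * R) ^ q))) *
        ∫ w : Data p × Data p, |w.1.1 l - w.2.1 l| ^ q ∂(Q.prod Q)) * kernelForm q Q a ≤
      ∫ w : Data p × Data p, w.1.2 * w.2.2 *
      (Real.exp (-∑ i, a i * |w.1.1 i - w.2.1 i| ^ q) * |w.1.1 l - w.2.1 l| ^ q)
        ∂(Q.prod Q) := by
  have hK := isCompact_closedBall (0 : Data p) R
  have hpr := ae_mem_prod hR hR
  have int : ∀ {f : Data p × Data p → ℝ}, Continuous f → Integrable f (Q.prod Q) := fun hf =>
    Continuous.integrable_of_ae_mem_compact hf (hK.prod hK) hpr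
  have hYi : Integrable (fun z : Data p => z.2) Q :=
    Continuous.integrable_of_ae_mem_compact continuous_snd hK hR
  have hl' : l ∈ Sᶜ := Finset.mem_compl.2 hl
  have hb0 : 0 ≤ b := (ha l).trans (hb l)
  set A : (S → ℝ) × (S → ℝ) → ℝ := fun x =>
    Real.exp (-∑ i : S, a i * |x.1 i - x.2 i| ^ q) with hA
  set B : ((Sᶜ : Finset (Fin p)) → ℝ) × ((Sᶜ : Finset (Fin p)) → ℝ) → ℝ := fun x =>
    Real.exp (-∑ i : (Sᶜ : Finset (Fin p)), a i * |x.1 i - x.2 i| ^ q) with hB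
  have hAc : Continuous A := by fun_prop
  have hBc : Continuous B := by fun_prop
  have hsplit : ∀ w : Data p × Data p, Real.exp (-∑ i, a i * |w.1.1 i - w.2.1 i| ^ q) =
      A (subFeatures S w.1, subFeatures S w.2) * B (subFeatures Sᶜ w.1, subFeatures Sᶜ w.2) := by
    intro w
    simp only [hA, hB, subFeatures]
    rw [← Real.exp_add, ← neg_add, Finset.sum_coe_sort S fun i => a i * |w.1.1 i - w.2.1 i| ^ q,
      Finset.sum_coe_sort Sᶜ fun i => a i * |w.1.1 i - w.2.1 i| ^ q, Finset.sum_add_sum_compl]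
  have f1 := hS.integral_prod_factor hR hAc hBc
  simp only [← hsplit] at f1
  rw [← kernelForm] at f1
  have f2 := hS.integral_prod_factor hR hAc (B := fun x => B x * |x.1 ⟨l, hl'⟩ - x.2 ⟨l, hl'⟩| ^ q)
    (by fun_prop)
  have f2' : ∫ w : Data p × Data p, w.1.2 * w.2.2 *
      (Real.exp (-∑ i, a i * |w.1.1 i - w.2.1 i| ^ q) * |w.1.1 l - w.2.1 l| ^ q) ∂(Q.prod Q) =
      ∫ w : Data p × Data p, w.1.2 * w.2.2 * (A (subFeatures S w.1, subFeatures S w.2) *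
        (B (subFeatures Sᶜ w.1, subFeatures Sᶜ w.2) *
        |subFeatures Sᶜ w.1 ⟨l, hl'⟩ - subFeatures Sᶜ w.2 ⟨l, hl'⟩| ^ q)) ∂(Q.prod Q) := by
    simp only [hsplit, mul_assoc]
    rfl
  -- The signal factor is the kernel form with all noise weights set to zero, so semidefiniteness at
  -- degenerate weights is needed.
  have hA0 : 0 ≤ ∫ w : Data p × Data p, w.1.2 * w.2.2 *
      A (subFeatures S w.1, subFeatures S w.2) ∂(Q.prod Q) := by
    have := kernelForm_nonneg (Q := Q) hq hYi (a := fun i => if i ∈ S then a i else 0)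
      fun i => by split_ifs; exacts [ha i, le_rfl]
    rw [kernelForm] at this
    simp only [ite_mul, zero_mul, Finset.sum_ite_mem, Finset.univ_inter] at this
    convert this using 5 with w
    simp only [subFeatures]
    rw [Finset.sum_coe_sort S fun i => a i * |w.1.1 i - w.2.1 i| ^ q]
  have hcB : Continuous fun w : Data p × Data p => B (subFeatures Sᶜ w.1, subFeatures Sᶜ w.2) :=
    hBc.comp (((continuous_subFeatures _).comp continuous_fst).prodMk
      ((continuous_subFeatures _).comp continuous_snd))
  have hB1 : ∫ w : Data p × Data p, B (subFeatures Sᶜ w.1, subFeatures Sᶜ w.2) ∂(Q.prod Q) ≤ 1 := by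
    have h1 := integral_mono (μ := Q.prod Q) (int hcB) (integrable_const (1 : ℝ)) fun w => by
      simp only [hB]
      refine Real.exp_le_one_iff.2 (neg_nonpos.2 (Finset.sum_nonneg fun i _ => ?_))
      exact mul_nonneg (ha i) (by positivity)
    simpa using h1
  -- Almost surely the noise exponent has at most `p` terms, each at most `b * (2 * R) ^ q`.
  have hB2 : Real.exp (-(p * (b * (2 * R) ^ q))) *
      ∫ w : Data p × Data p, |w.1.1 l - w.2.1 l| ^ q ∂(Q.prod Q) ≤
      ∫ w : Data p × Data p, B (subFeatures Sᶜ w.1, subFeatures Sᶜ w.2) *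
        |subFeatures Sᶜ w.1 ⟨l, hl'⟩ - subFeatures Sᶜ w.2 ⟨l, hl'⟩| ^ q ∂(Q.prod Q) := by
    rw [← integral_const_mul]
    refine integral_mono_ae (int (by fun_prop)) (int (hcB.mul (by unfold subFeatures; fun_prop))) ?_
    filter_upwards [hpr] with w hw
    refine mul_le_mul_of_nonneg_right (Real.exp_le_exp.2 (neg_le_neg ?_)) (by positivity)
    have hterm : ∀ i ∈ (Sᶜ : Finset (Fin p)), a i * |w.1.1 i - w.2.1 i| ^ q ≤ b * (2 * R) ^ q := by
      intro i _
      have h1 : ∀ z ∈ Metric.closedBall (0 : Data p) R, |z.1 i| ≤ R := fun z hz =>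
        (norm_le_pi_norm z.1 i).trans ((norm_fst_le z).trans (by simpa using hz))
      have h2 : |w.1.1 i - w.2.1 i| ≤ 2 * R := by
        have := abs_sub (w.1.1 i) (w.2.1 i)
        linarith [h1 _ hw.1, h1 _ hw.2]
      exact mul_le_mul (hb i) (pow_le_pow_left₀ (abs_nonneg _) h2 q) (by positivity) hb0
    have hR0 : 0 ≤ b * (2 * R) ^ q := (mul_nonneg (ha l) (by positivity)).trans (hterm l hl')
    simp only [subFeatures]
    rw [Finset.sum_coe_sort Sᶜ fun i => a i * |w.1.1 i - w.2.1 i| ^ q]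
    refine (Finset.sum_le_card_nsmul _ _ _ hterm).trans ?_
    rw [nsmul_eq_mul]
    refine mul_le_mul_of_nonneg_right ?_ hR0
    exact_mod_cast (Finset.card_le_univ _).trans_eq (Fintype.card_fin p)
  rw [f2', f2, f1]
  have hC0 : 0 ≤ Real.exp (-(p * (b * (2 * R) ^ q))) *
      ∫ w : Data p × Data p, |w.1.1 l - w.2.1 l| ^ q ∂(Q.prod Q) := by positivity
  calc _ ≤ (Real.exp (-(p * (b * (2 * R) ^ q))) *
      ∫ w : Data p × Data p, |w.1.1 l - w.2.1 l| ^ q ∂(Q.prod Q)) * _ :=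
        mul_le_mul_of_nonneg_left (mul_le_of_le_one_right hA0 hB1) hC0
    _ ≤ _ := by
        rw [mul_comm]
        exact mul_le_mul_of_nonneg_left hB2 hA0

/-- A nondegenerate coordinate differs between two independent samples. -/
theorem DataAssumption.integral_abs_sub_pow_pos (hQ : DataAssumption Q)
    (hR : ∀ᵐ z ∂Q, z ∈ Metric.closedBall (0 : Data p) R) (hq : q ≠ 0) (l : Fin p) :
    0 < ∫ w : Data p × Data p, |w.1.1 l - w.2.1 l| ^ q ∂(Q.prod Q) := by
  refine (integral_nonneg fun w => by positivity).lt_of_ne fun h0 => ?_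
  have hK := isCompact_closedBall (0 : Data p) R
  rw [eq_comm, integral_eq_zero_iff_of_nonneg (fun w => by positivity)
    (Continuous.integrable_of_ae_mem_compact (by fun_prop) (hK.prod hK) (ae_mem_prod hR hR))] at h0
  -- If independent copies agree almost surely, the coordinate equals a constant almost surely,
  -- against positive variance.
  obtain ⟨z, hz⟩ := (Measure.ae_ae_of_ae_prod h0).exists
  have hconst : (fun z : Data p => z.1 l) =ᵐ[Q] fun _ => z.1 l := by
    filter_upwards [hz] with z' hz'
    have h1 : |z.1 l - z'.1 l| = 0 := pow_eq_zero_iff hq |>.1 hz'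
    linarith [abs_eq_zero.1 h1]
  have := hQ.variance_pos l
  rw [variance_congr hconst, variance_eq_integral aemeasurable_const] at this
  simp at this

/-- The population partial derivative in a noise direction is at least a positive multiple of
the negative objective. -/
theorem exists_mul_neg_mlObjective_le (hq : q = 1 ∨ q = 2) (hμ : KernelAssumption μ)
    (hQ : DataAssumption Q) {S : Finset (Fin p)} (hS : SeparatesSignal Q S) (M : ℝ) (l : Fin p)
    (hl : l ∉ S) :
    ∃ κ > 0, ∀ β ∈ feasibleBox p M, κ * -mlObjective μ q Q β ≤ mlPartial μ q Q β l := by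
  obtain ⟨m, hm0, m', hm⟩ := hμ.exists_Icc
  obtain ⟨R, -, hR⟩ := hQ.exists_closedBall
  have hpos := hQ.integral_abs_sub_pow_pos (q := q) hR (by omega) l
  set c := Real.exp (-(p * (m' * M * (2 * R) ^ q))) *
    ∫ w : Data p × Data p, |w.1.1 l - w.2.1 l| ^ q ∂(Q.prod Q) with hc
  have hc0 : 0 < c := mul_pos (Real.exp_pos _) hpos
  -- The factor `m` bounds from below the `t` produced by differentiating the exponential; `m' * M`
  -- in `c` bounds the weights `t * β i`.
  refine ⟨m * c, mul_pos hm0 hc0, fun β hβ => ?_⟩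
  have hYi : Integrable (fun z : Data p => z.2) Q :=
    Continuous.integrable_of_ae_mem_compact continuous_snd (isCompact_closedBall _ _) hR
  obtain ⟨hint, heq⟩ := mlPartial_eq (q := q) hR hm β l
  rw [mlObjective_eq hR hm, neg_neg, heq, ← integral_const_mul]
  refine integral_mono_ae ((integrable_kernelForm hR hm β).const_mul _) hint ?_
  filter_upwards [hm] with t ht
  have ht0 : 0 ≤ t := hm0.le.trans ht.1
  have ha : ∀ i, 0 ≤ t * β i := fun i => mul_nonneg ht0 (hβ i).1
  have h1 := hS.kernelForm_le hq hR hl ha (b := m' * M)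
    fun i => mul_le_mul ht.2 (hβ i).2 (hβ i).1 (ht0.trans ht.2)
  rw [← hc] at h1
  have h2 := kernelForm_nonneg (Q := Q) hq hYi ha
  calc m * c * kernelForm q Q (fun i => t * β i)
      ≤ t * c * kernelForm q Q (fun i => t * β i) := by gcongr; exact ht.1
    _ = t * (c * kernelForm q Q (fun i => t * β i)) := mul_assoc _ _ _
    _ ≤ _ := mul_le_mul_of_nonneg_left h1 ht0

/-- If `E[Y | X]` vanished it would equal `E[Y]`, so the empty set would separate the signal,
against minimality of `S`. -/
theorem IsSignalSet.condExp_ne_zero (hY0 : ∫ z, z.2 ∂Q = 0) {S : Finset (Fin p)}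
    (hS : IsSignalSet Q S) (hne : S.Nonempty) :
    ¬ Q[fun z => z.2 | MeasurableSpace.comap (fun z : Data p => z.1) inferInstance] =ᵐ[Q] 0 := by
  intro h0
  have hempty : SeparatesSignal Q (∅ : Finset (Fin p)) := by
    have hconst : subFeatures (p := p) ∅ =
        fun _ => fun i : (∅ : Finset (Fin p)) => absurd i.2 (Finset.notMem_empty _) :=
      funext fun _ => Subsingleton.elim _ _
    have hbot : MeasurableSpace.comap (subFeatures (p := p) ∅) inferInstance = ⊥ := by
      rw [hconst, MeasurableSpace.comap_const]
    refine ⟨h0.trans ?_, ?_⟩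
    · rw [hbot, condExp_bot, hY0]; rfl
    · rw [hconst]
      exact indepFun_const_left _ _
  exact hne.ne_empty (Finset.subset_empty.1 (hS.2 hempty (Finset.empty_subset S)))

/-- The population objective is negative at full-support weights. -/
theorem mlObjective_neg (hq : q = 1 ∨ q = 2) (hμ : KernelAssumption μ)
    (hQ : DataAssumption Q) {S : Finset (Fin p)} (hS : IsSignalSet Q S) (hne : S.Nonempty)
    {β : EuclideanSpace ℝ (Fin p)} (hβ : ∀ i, 0 < β i) : mlObjective μ q Q β < 0 := by
  obtain ⟨m, hm0, m', hm⟩ := hμ.exists_Icc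
  obtain ⟨R, -, hR⟩ := hQ.exists_closedBall
  have hYi : Integrable (fun z : Data p => z.2) Q :=
    Continuous.integrable_of_ae_mem_compact continuous_snd (isCompact_closedBall _ _) hR
  have hpos : ∀ᵐ t ∂μ, 0 < kernelForm q Q fun i => t * β i := by
    filter_upwards [hm] with t ht
    exact kernelForm_pos hq hYi (hS.condExp_ne_zero hQ.centered hne)
      fun i => mul_pos (hm0.trans_le ht.1) (hβ i)
  rw [mlObjective_eq hR hm, neg_lt_zero]
  refine (integral_nonneg_of_ae (hpos.mono fun t ht => ht.le)).lt_of_ne fun h0 => ?_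
  rw [eq_comm, integral_eq_zero_iff_of_nonneg_ae (hpos.mono fun t ht => ht.le)
    (integrable_kernelForm hR hm β)] at h0
  have : NeZero μ := ⟨hμ.ne_zero⟩
  obtain ⟨t, h1, h2⟩ := (hpos.and h0).exists
  exact h1.ne' h2

end Population
end MetricLearning

namespace MetricLearning

open Set Filter Topology
open scoped NNReal ENNReal

/-! ### Smoothness of the kernel profile. -/

section KernelProfile

variable {μ : Measure ℝ} {m m' : ℝ}

/-- Bounded support makes the moment generating function analytic everywhere, which supplies the
derivatives of the profile. -/
theorem kernelProfile_eq_mgf (s : ℝ) : kernelProfile μ s = mgf id μ (-s) := by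
  simp only [kernelProfile, mgf, id]
  congr 1 with t
  ring_nf

variable [IsFiniteMeasure μ]

theorem mem_interior_integrableExpSet (hm : ∀ᵐ t ∂μ, t ∈ Icc m m') (s : ℝ) :
    s ∈ interior (integrableExpSet id μ) := by
  have : integrableExpSet id μ = univ := eq_univ_of_forall fun u =>
    Continuous.integrable_of_ae_mem_compact (by fun_prop) isCompact_Icc hm
  rw [this, interior_univ]
  trivial

theorem contDiff_kernelProfile (hm : ∀ᵐ t ∂μ, t ∈ Icc m m') : ContDiff ℝ 1 (kernelProfile μ) := by
  have h : ContDiff ℝ 1 (mgf id μ) := contDiff_iff_contDiffAt.2 fun s =>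
    (analyticAt_mgf (mem_interior_integrableExpSet hm s)).contDiffAt
  rw [funext (kernelProfile_eq_mgf (μ := μ))]
  exact h.comp contDiff_neg

theorem hasDerivAt_kernelProfile (hm : ∀ᵐ t ∂μ, t ∈ Icc m m') (s : ℝ) :
    HasDerivAt (kernelProfile μ) (-∫ t, t * Real.exp (-t * s) ∂μ) s := by
  have h := (hasDerivAt_mgf (mem_interior_integrableExpSet hm (-s))).scomp s (hasDerivAt_neg s)
  rw [funext (kernelProfile_eq_mgf (μ := μ))]
  refine h.congr_deriv ?_
  simp only [id, neg_smul, one_smul]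
  congr 2 with t
  ring_nf

theorem continuous_integral_mul_exp (hm : ∀ᵐ t ∂μ, t ∈ Icc m m') :
    Continuous fun s => ∫ t, t * Real.exp (-t * s) ∂μ := by
  have h := (contDiff_kernelProfile hm).continuous_deriv le_rfl
  have h2 : deriv (kernelProfile μ) = fun s => -∫ t, t * Real.exp (-t * s) ∂μ :=
    funext fun s => (hasDerivAt_kernelProfile hm s).deriv
  rw [h2] at h
  exact h.neg.congr fun s => neg_neg _

end KernelProfile

/-! ### The empirical objective and its gradient. -/

section Empirical

variable {p n : ℕ}

theorem isProbabilityMeasure_empiricalMeasure (hn : n ≠ 0) (z : Fin n → Data p) :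
    IsProbabilityMeasure (empiricalMeasure z) := by
  constructor
  simp only [empiricalMeasure, Measure.smul_apply, Measure.finsetSum_apply, measure_univ, smul_eq_mul,
    Finset.sum_const, Finset.card_univ, Fintype.card_fin, nsmul_eq_mul, mul_one]
  exact ENNReal.inv_mul_cancel (by exact_mod_cast hn) (ENNReal.natCast_ne_top n)

theorem ae_mem_empiricalMeasure {z : Fin n → Data p} {K : Set (Data p)} (h : ∀ i, z i ∈ K) :
    ∀ᵐ x ∂empiricalMeasure z, x ∈ K := by
  refine Measure.ae_smul_measure ?_ _
  rw [ae_finsetSum_measure_iff]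
  intro i _
  rw [ae_dirac_eq]
  exact h i

theorem integral_empiricalMeasure (z : Fin n → Data p) (f : Data p → ℝ) :
    ∫ x, f x ∂empiricalMeasure z = (n : ℝ)⁻¹ * ∑ i, f (z i) := by
  rw [empiricalMeasure, integral_smul_measure, integral_finsetSum_measure
    fun i _ => integrable_dirac enorm_lt_top]
  simp [integral_dirac]

theorem integral_empiricalMeasure_prod (hn : n ≠ 0) (z : Fin n → Data p)
    {f : Data p × Data p → ℝ} (hf : Continuous f) :
    ∫ w, f w ∂(empiricalMeasure z).prod (empiricalMeasure z) =
      ((n : ℝ)⁻¹) ^ 2 * ∑ i, ∑ j, f (z i, z j) := by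
  have := isProbabilityMeasure_empiricalMeasure hn z
  have hK : IsCompact (range z) := (finite_range z).isCompact
  have hae := ae_mem_empiricalMeasure (K := range z) fun i => mem_range_self i
  rw [integral_prod _ (Continuous.integrable_of_ae_mem_compact hf (hK.prod hK)
    (ae_mem_prod hae hae)), integral_empiricalMeasure]
  simp only [integral_empiricalMeasure]
  rw [← Finset.mul_sum, sq, mul_assoc]

/-- `weightedNormPow` as a linear functional of the weights. -/
noncomputable def weightedNormPowCLM (q : ℕ) (v : Fin p → ℝ) :
    EuclideanSpace ℝ (Fin p) →L[ℝ] ℝ :=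
  ∑ i, |v i| ^ q • (EuclideanSpace.proj i : EuclideanSpace ℝ (Fin p) →L[ℝ] ℝ)

theorem weightedNormPowCLM_apply (q : ℕ) (v : Fin p → ℝ) (β : EuclideanSpace ℝ (Fin p)) :
    weightedNormPowCLM q v β = weightedNormPow q β v := by
  simp [weightedNormPowCLM, weightedNormPow, mul_comm]

variable {μ : Measure ℝ} [IsFiniteMeasure μ] {m m' : ℝ} {q : ℕ}

theorem continuous_mlObjective_integrand (hm : ∀ᵐ t ∂μ, t ∈ Icc m m') :
    Continuous fun x : EuclideanSpace ℝ (Fin p) × (Data p × Data p) => x.2.1.2 * x.2.2.2 *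
      kernelProfile μ (weightedNormPow q x.1 (x.2.1.1 - x.2.2.1)) := by
  have h1 := (contDiff_kernelProfile hm).continuous
  have h2 : Continuous fun x : EuclideanSpace ℝ (Fin p) × (Data p × Data p) =>
      weightedNormPow q x.1 (x.2.1.1 - x.2.2.1) := by
    unfold weightedNormPow; fun_prop
  have h3 := h1.comp h2
  simp only [Function.comp_def] at h3
  fun_prop

theorem continuous_mlPartial_integrand (hm : ∀ᵐ t ∂μ, t ∈ Icc m m') (l : Fin p) :
    Continuous fun x : EuclideanSpace ℝ (Fin p) × (Data p × Data p) => x.2.1.2 * x.2.2.2 *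
      ((∫ t, t * Real.exp (-t * weightedNormPow q x.1 (x.2.1.1 - x.2.2.1)) ∂μ) *
        |x.2.1.1 l - x.2.2.1 l| ^ q) := by
  have h2 : Continuous fun x : EuclideanSpace ℝ (Fin p) × (Data p × Data p) =>
      weightedNormPow q x.1 (x.2.1.1 - x.2.2.1) := by
    unfold weightedNormPow; fun_prop
  have h3 := (continuous_integral_mul_exp hm).comp h2
  simp only [Function.comp_def] at h3
  fun_prop

theorem mlObjective_empiricalMeasure (hm : ∀ᵐ t ∂μ, t ∈ Icc m m') (hn : n ≠ 0)
    (z : Fin n → Data p) (β : EuclideanSpace ℝ (Fin p)) :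
    mlObjective μ q (empiricalMeasure z) β = -(((n : ℝ)⁻¹) ^ 2 * ∑ i, ∑ j, (z i).2 * (z j).2 *
      kernelProfile μ (weightedNormPowCLM q ((z i).1 - (z j).1) β)) := by
  have hc := (continuous_mlObjective_integrand (q := q) hm).comp (Continuous.prodMk_right β)
  simp only [Function.comp_def] at hc
  rw [mlObjective, integral_empiricalMeasure_prod hn z hc]
  simp only [weightedNormPowCLM_apply]

theorem contDiff_mlObjective_empiricalMeasure (hm : ∀ᵐ t ∂μ, t ∈ Icc m m') (hn : n ≠ 0)
    (z : Fin n → Data p) : ContDiff ℝ 1 (mlObjective μ q (empiricalMeasure z)) := by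
  have h1 := contDiff_kernelProfile hm
  rw [funext (mlObjective_empiricalMeasure (q := q) hm hn z)]
  fun_prop

/-- The coordinates of the gradient of the empirical objective are given by `mlPartial`. -/
theorem gradient_mlObjective_empiricalMeasure (hm : ∀ᵐ t ∂μ, t ∈ Icc m m') (hn : n ≠ 0)
    (z : Fin n → Data p) (β : EuclideanSpace ℝ (Fin p)) (l : Fin p) :
    gradient (mlObjective μ q (empiricalMeasure z)) β l = mlPartial μ q (empiricalMeasure z) β l := by
  set e : EuclideanSpace ℝ (Fin p) := EuclideanSpace.single l 1 with he
  have h1 : gradient (mlObjective μ q (empiricalMeasure z)) β l =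
      fderiv ℝ (mlObjective μ q (empiricalMeasure z)) β e := by
    rw [← inner_gradient_left, he, EuclideanSpace.inner_single_right]
    simp
  have hterm : ∀ i j, HasFDerivAt (fun β => (z i).2 * (z j).2 *
      kernelProfile μ (weightedNormPowCLM q ((z i).1 - (z j).1) β)) (((z i).2 * (z j).2) •
      ((-∫ t, t * Real.exp (-t * weightedNormPow q β ((z i).1 - (z j).1)) ∂μ) •
        weightedNormPowCLM q ((z i).1 - (z j).1))) β := by
    intro i j
    have h := hasDerivAt_kernelProfile hm (weightedNormPowCLM q ((z i).1 - (z j).1) β)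
    have h2 := (h.comp_hasFDerivAt β (weightedNormPowCLM q ((z i).1 - (z j).1)).hasFDerivAt).const_mul
      ((z i).2 * (z j).2)
    rw [weightedNormPowCLM_apply] at h2
    exact h2
  have hsum := ((HasFDerivAt.fun_sum fun i _ => HasFDerivAt.fun_sum fun j _ =>
    hterm i j : HasFDerivAt (fun β => ∑ i, ∑ j, (z i).2 * (z j).2 *
      kernelProfile μ (weightedNormPowCLM q ((z i).1 - (z j).1) β)) _ β).const_mul
        (((n : ℝ)⁻¹) ^ 2)).fun_neg
  have hc := (continuous_mlPartial_integrand (q := q) hm l).comp (Continuous.prodMk_right β)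
  simp only [Function.comp_def] at hc
  rw [h1, funext (mlObjective_empiricalMeasure (q := q) hm hn z), hsum.fderiv, mlPartial,
    integral_empiricalMeasure_prod hn z hc]
  have hval : ∀ v : Fin p → ℝ, weightedNormPowCLM q v e = |v l| ^ q := by
    intro v
    simp [weightedNormPowCLM, he]
  simp only [neg_apply, smul_apply,
    sum_apply, hval, smul_eq_mul, Pi.sub_apply, neg_mul, mul_neg,
    Finset.sum_neg_distrib, neg_neg]

end Empirical
end MetricLearning

namespace MetricLearning

open Set Filter Topology
open scoped NNReal ENNReal

/-! ### Reduction of uniform deviations to finitely many cells. -/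

section Discretization

variable {X T : Type*} [MeasurableSpace X]

/-- The integral of a function of a simple function. -/
theorem integral_comp_simpleFunc (π : SimpleFunc X X) (ν : Measure X) [IsFiniteMeasure ν]
    (g : X → ℝ) : ∫ x, g (π x) ∂ν = ∑ a ∈ π.range, ν.real (π ⁻¹' {a}) * g a := by
  have h : ∀ x, g (π x) = ∑ a ∈ π.range, (π ⁻¹' {a}).indicator (fun _ => g a) x := by
    intro x
    rw [Finset.sum_eq_single_of_mem (π x) (SimpleFunc.mem_range_self π x)]
    · simp
    · intro b _ hb
      simp [hb.symm]
  simp only [h]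
  rw [integral_finsetSum _ fun a _ =>
    (integrable_const (g a)).indicator (SimpleFunc.measurableSet_fiber π a)]
  exact Finset.sum_congr rfl fun a _ => by
    rw [integral_indicator_const _ (SimpleFunc.measurableSet_fiber π a), smul_eq_mul]

theorem integral_prod_comp_simpleFunc (π : SimpleFunc X X) (ν : Measure X) [IsFiniteMeasure ν]
    (g : X × X → ℝ) (hint : Integrable (fun w : X × X => g (π w.1, π w.2)) (ν.prod ν)) :
    ∫ w, g (π w.1, π w.2) ∂ν.prod ν =
      ∑ a ∈ π.range, ∑ b ∈ π.range, ν.real (π ⁻¹' {a}) * ν.real (π ⁻¹' {b}) * g (a, b) := by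
  rw [integral_prod _ hint]
  have h : ∀ x, ∫ y, g (π x, π y) ∂ν = ∑ b ∈ π.range, ν.real (π ⁻¹' {b}) * g (π x, b) := fun x =>
    integral_comp_simpleFunc π ν fun b => g (π x, b)
  simp only [h]
  rw [integral_comp_simpleFunc π ν fun a => ∑ b ∈ π.range, ν.real (π ⁻¹' {b}) * g (a, b)]
  simp only [Finset.mul_sum, mul_assoc]

variable [MetricSpace X] [BorelSpace X]

/-- A simple function which moves the points of a compact set by less than `δ`. -/
theorem exists_simpleFunc_dist_lt {K : Set X} (hK : IsCompact K) (hne : K.Nonempty) {δ : ℝ}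
    (hδ : 0 < δ) : ∃ π : SimpleFunc X X, (∀ x, π x ∈ K) ∧ ∀ x ∈ K, dist (π x) x < δ := by
  obtain ⟨t, htK, htf, hcover⟩ := hK.finite_cover_balls hδ
  have htne : t.Nonempty := by
    obtain ⟨x, hx⟩ := hne
    obtain ⟨y, hy, -⟩ := mem_iUnion₂.1 (hcover hx)
    exact ⟨y, hy⟩
  -- All values of the enumeration lie in the finite net, hence in `K`; `N` is large enough that the
  -- first indices already reach every net point.
  obtain ⟨e, he⟩ := htf.countable.exists_eq_range htne
  have hidx : ∀ y ∈ t, ∃ k, e k = y := fun y hy => by rw [he] at hy; exact hy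
  choose! k hk using hidx
  obtain ⟨N, hN⟩ := (htf.image k).bddAbove
  refine ⟨SimpleFunc.nearestPt e N, fun x => htK (he ▸ mem_range_self _), fun x hx => ?_⟩
  obtain ⟨y, hy, hxy⟩ := mem_iUnion₂.1 (hcover hx)
  have h1 := SimpleFunc.edist_nearestPt_le e x (hN (mem_image_of_mem k hy))
  rw [hk y hy, edist_dist, edist_dist, ENNReal.ofReal_le_ofReal_iff dist_nonneg] at h1
  exact h1.trans_lt (by rwa [dist_comm])

variable [SecondCountableTopology X] [MetricSpace T]

/-- Two-sample averages of finitely many equicontinuous compact families are uniformly controlled by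
the probabilities of finitely many cells. -/
theorem exists_simpleFunc_integral_sub_le {ι : Type*} [Finite ι] {K : Set X} (hK : IsCompact K)
    (hne : K.Nonempty) {B : Set T} (hB : IsCompact B) {G : ι → T × (X × X) → ℝ}
    (hG : ∀ i, Continuous (G i)) (Q : Measure X) [IsProbabilityMeasure Q] (hQ : ∀ᵐ x ∂Q, x ∈ K)
    {ε : ℝ} (hε : 0 < ε) :
    ∃ π : SimpleFunc X X, ∃ η > 0, ∀ ν : Measure X, IsProbabilityMeasure ν → (∀ᵐ x ∂ν, x ∈ K) →
      (∀ a ∈ π.range, |ν.real (π ⁻¹' {a}) - Q.real (π ⁻¹' {a})| ≤ η) → ∀ i, ∀ t ∈ B,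
        |∫ w, G i (t, w) ∂ν.prod ν - ∫ w, G i (t, w) ∂Q.prod Q| ≤ ε := by
  have hcomp := hB.prod (hK.prod hK)
  have hδ : ∀ᶠ δ in 𝓝[>] (0 : ℝ), ∀ i, ∀ t ∈ B, ∀ w ∈ K ×ˢ K, ∀ w' ∈ K ×ˢ K, dist w w' < δ →
      |G i (t, w) - G i (t, w')| ≤ ε / 3 := by
    refine eventually_all.2 fun i => ?_
    obtain ⟨δ, hδ0, hδ⟩ := Metric.uniformContinuousOn_iff.1
      (hcomp.uniformContinuousOn_of_continuous (hG i).continuousOn) (ε / 3) (by positivity)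
    filter_upwards [Ioo_mem_nhdsGT hδ0] with δ' hδ' t ht w hw w' hw' hd
    have := hδ (t, w) ⟨ht, hw⟩ (t, w') ⟨ht, hw'⟩ (by
      rw [Prod.dist_eq, dist_self]
      exact max_lt hδ0 (hd.trans hδ'.2))
    rw [Real.dist_eq] at this
    exact this.le
  obtain ⟨δ, hδ, hδ0⟩ := (hδ.and self_mem_nhdsWithin).exists
  obtain ⟨π, hπK, hπ⟩ := exists_simpleFunc_dist_lt hK hne hδ0
  have hbdd : ∃ C : ℝ, 0 ≤ C ∧ ∀ i, ∀ x ∈ B ×ˢ (K ×ˢ K), |G i x| ≤ C := by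
    choose C hC using fun i => hcomp.exists_bound_of_continuousOn (hG i).continuousOn
    obtain ⟨D, hD⟩ := (finite_range C).bddAbove
    exact ⟨max D 0, le_max_right _ _, fun i x hx => (hC i x hx).trans
      ((hD (mem_range_self i)).trans (le_max_left _ _))⟩
  obtain ⟨C, hC0, hC⟩ := hbdd
  set N : ℝ := (π.range.card : ℝ) with hN
  -- Each of the `N * N` pairs of cells changes the sum by at most `2 * η * C`, in total at most `ε
  -- / 3`. The other two thirds pay for rounding under `ν` and under `Q`.
  refine ⟨π, ε / (3 * (N * N * (2 * C) + 1)), by positivity, fun ν hR hRK hcells i t ht => ?_⟩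
  have happrox : ∀ ν : Measure X, IsProbabilityMeasure ν → (∀ᵐ x ∂ν, x ∈ K) →
      |∫ w, G i (t, w) ∂ν.prod ν - ∑ a ∈ π.range, ∑ b ∈ π.range,
        ν.real (π ⁻¹' {a}) * ν.real (π ⁻¹' {b}) * G i (t, (a, b))| ≤ ε / 3 := by
    intro ν hR hRK
    have hpr := ae_mem_prod hRK hRK
    have hGt : Continuous fun w => G i (t, w) := (hG i).comp (Continuous.prodMk_right t)
    have hint : Integrable (fun w : X × X => G i (t, (π w.1, π w.2))) (ν.prod ν) := by
      refine Integrable.of_bound (C := C) ?_ (Eventually.of_forall fun w =>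
        hC i _ ⟨ht, hπK _, hπK _⟩)
      refine (hGt.measurable.comp ?_).aestronglyMeasurable
      exact (π.measurable.comp measurable_fst).prodMk (π.measurable.comp measurable_snd)
    rw [← integral_prod_comp_simpleFunc π ν (fun w => G i (t, w)) hint,
      ← integral_sub (Continuous.integrable_of_ae_mem_compact
        hGt (hK.prod hK) hpr) hint]
    have h1 := norm_integral_le_of_norm_le_const (μ := ν.prod ν) (C := ε / 3)
      (f := fun w : X × X => G i (t, w) - G i (t, (π w.1, π w.2))) (hpr.mono fun w hw =>
        hδ i t ht w hw _ ⟨hπK _, hπK _⟩ (by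
          rw [Prod.dist_eq, dist_comm, dist_comm w.2]
          exact max_lt (hπ _ hw.1) (hπ _ hw.2)))
    simpa using h1
  have h1 := happrox ν hR hRK
  have h2 := happrox Q inferInstance hQ
  have h3 : |(∑ a ∈ π.range, ∑ b ∈ π.range,
        ν.real (π ⁻¹' {a}) * ν.real (π ⁻¹' {b}) * G i (t, (a, b))) - ∑ a ∈ π.range, ∑ b ∈ π.range,
        Q.real (π ⁻¹' {a}) * Q.real (π ⁻¹' {b}) * G i (t, (a, b))| ≤ ε / 3 := by
    rw [← Finset.sum_sub_distrib]
    simp only [← Finset.sum_sub_distrib, ← sub_mul]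
    set η := ε / (3 * (N * N * (2 * C) + 1)) with hη
    have hη0 : 0 ≤ η := by positivity
    have hterm : ∀ a ∈ π.range, ∀ b ∈ π.range, |(ν.real (π ⁻¹' {a}) * ν.real (π ⁻¹' {b}) -
        Q.real (π ⁻¹' {a}) * Q.real (π ⁻¹' {b})) * G i (t, (a, b))| ≤ 2 * η * C := by
      intro a ha b hb
      have hmem : ∀ c ∈ π.range, c ∈ K := fun c hc => by
        obtain ⟨x, rfl⟩ := SimpleFunc.mem_range.1 hc
        exact hπK x
      rw [abs_mul]
      refine mul_le_mul ?_ (hC i _ ⟨ht, hmem a ha, hmem b hb⟩) (abs_nonneg _) (by positivity)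
      have e1 : ν.real (π ⁻¹' {a}) * ν.real (π ⁻¹' {b}) - Q.real (π ⁻¹' {a}) * Q.real (π ⁻¹' {b}) =
        (ν.real (π ⁻¹' {a}) - Q.real (π ⁻¹' {a})) * ν.real (π ⁻¹' {b}) +
        Q.real (π ⁻¹' {a}) * (ν.real (π ⁻¹' {b}) - Q.real (π ⁻¹' {b})) := by ring
      rw [e1]
      refine (abs_add_le _ _).trans ?_
      rw [abs_mul, abs_mul, abs_of_nonneg measureReal_nonneg, abs_of_nonneg measureReal_nonneg]
      have h4 := mul_le_mul (hcells a ha) (measureReal_le_one (μ := ν) (s := π ⁻¹' {b}))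
        measureReal_nonneg hη0
      have h5 := mul_le_mul (measureReal_le_one (μ := Q) (s := π ⁻¹' {a})) (hcells b hb)
        (abs_nonneg _) zero_le_one
      linarith
    refine (Finset.abs_sum_le_sum_abs _ _).trans ?_
    refine (Finset.sum_le_card_nsmul _ _ (N * (2 * η * C)) fun a ha => ?_).trans ?_
    · refine (Finset.abs_sum_le_sum_abs _ _).trans ?_
      refine (Finset.sum_le_card_nsmul _ _ _ fun b hb => hterm a ha b hb).trans ?_
      rw [nsmul_eq_mul]
    · rw [nsmul_eq_mul, ← hN, hη]
      have : 0 ≤ N * N * (2 * C) := by positivity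
      rw [show N * (N * (2 * (ε / (3 * (N * N * (2 * C) + 1))) * C)) =
        (N * N * (2 * C)) / (N * N * (2 * C) + 1) * (ε / 3) by field_simp]
      exact mul_le_of_le_one_left (by positivity) ((div_le_one (by positivity)).2 (by linarith))
  rw [abs_le] at *
  constructor <;> linarith [h1.1, h1.2, h2.1, h2.2, h3.1, h3.2]

end Discretization

/-! ### Hoeffding bounds for cell frequencies. -/

section Hoeffding

theorem measureReal_empiricalMeasure {p n : ℕ} (z : Fin n → Data p) {C : Set (Data p)}
    (hC : MeasurableSet C) :
    (empiricalMeasure z).real C = (n : ℝ)⁻¹ * ∑ i, C.indicator (fun _ => (1 : ℝ)) (z i) := by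
  have h := integral_empiricalMeasure z (C.indicator fun _ => (1 : ℝ))
  rwa [integral_indicator_const _ hC, smul_eq_mul, mul_one] at h

variable {p n : ℕ} {Q : Measure (Data p)} {Ω : Type*} [MeasurableSpace Ω]
  {P : Measure Ω} [IsProbabilityMeasure P] {Z : Fin n → Ω → Data p}

/-- One-sided Hoeffding bound for empirical frequencies. -/
theorem measureReal_empirical_ge_le (hn : n ≠ 0) (hZ : ∀ i, Measurable (Z i))
    (hind : iIndepFun Z P) (hlaw : ∀ i, P.map (Z i) = Q) {C : Set (Data p)} (hC : MeasurableSet C)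
    {η : ℝ} (hη : 0 ≤ η) :
    P.real {ω | η ≤ (empiricalMeasure fun i => Z i ω).real C - Q.real C} ≤
      Real.exp (-(2 * η ^ 2) * n) := by
  set f : Data p → ℝ := C.indicator fun _ => (1 : ℝ) with hf
  have hfm : Measurable f := measurable_const.indicator hC
  have hf01 : ∀ z, f z ∈ Icc (0 : ℝ) 1 := fun z => by
    by_cases h : z ∈ C <;> simp [hf, h]
  have hmean : ∀ i, ∫ ω, f (Z i ω) ∂P = Q.real C := by
    intro i
    rw [← integral_map (hZ i).aemeasurable hfm.aestronglyMeasurable, hlaw i, hf,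
      integral_indicator_const _ hC]
    simp
  have hsub : ∀ i, HasSubgaussianMGF (fun ω => f (Z i ω) - Q.real C) ((‖(1 : ℝ) - 0‖₊ / 2) ^ 2) P := by
    intro i
    rw [← hmean i]
    exact hasSubgaussianMGF_of_mem_Icc (X := fun ω => f (Z i ω)) (hfm.comp (hZ i)).aemeasurable
      (Eventually.of_forall fun ω => hf01 _)
  have hindf : iIndepFun (fun i ω => f (Z i ω) - Q.real C) P :=
    hind.comp (fun _ z => f z - Q.real C) fun _ => hfm.sub_const _
  have h := HasSubgaussianMGF.measure_sum_ge_le_of_iIndepFun hindf (s := Finset.univ)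
    (fun i _ => hsub i) (ε := n * η) (by positivity)
  have hn0 : (0 : ℝ) < n := by positivity
  have hset : {ω | η ≤ (empiricalMeasure fun i => Z i ω).real C - Q.real C} =
      {ω | n * η ≤ ∑ i, (f (Z i ω) - Q.real C)} := by
    ext ω
    simp only [mem_ofPred_eq]
    rw [measureReal_empiricalMeasure _ hC, Finset.sum_sub_distrib, Finset.sum_const,
      Finset.card_univ, Fintype.card_fin, nsmul_eq_mul, ← hf,
      ← mul_le_mul_iff_right₀ hn0, mul_sub, mul_inv_cancel_left₀ hn0.ne']
  rw [hset]
  refine h.trans_eq (congrArg Real.exp ?_)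
  simp only [sub_zero, nnnorm_one, Finset.sum_const, Finset.card_univ, Fintype.card_fin]
  push_cast
  field_simp
  ring

/-- Uniform concentration of the empirical frequencies of finitely many sets. -/
theorem exists_empirical_concentration (Q : Measure (Data p)) [IsProbabilityMeasure Q]
    {α : Type*} (s : Finset α) (C : α → Set (Data p))
    (hC : ∀ a, MeasurableSet (C a)) {η : ℝ} (hη : 0 < η) :
    ∃ c > (0 : ℝ), ∃ n₀ : ℕ, n₀ ≠ 0 ∧ ∀ n ≥ n₀, ∀ (Ω : Type*) [MeasurableSpace Ω] (P : Measure Ω)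
      [IsProbabilityMeasure P] (Z : Fin n → Ω → Data p), (∀ i, Measurable (Z i)) → iIndepFun Z P →
      (∀ i, P.map (Z i) = Q) → ∃ A : Set Ω, MeasurableSet A ∧ 1 - Real.exp (-c * n) ≤ P.real A ∧
        ∀ ω ∈ A, ∀ a ∈ s,
          |(empiricalMeasure fun i => Z i ω).real (C a) - Q.real (C a)| ≤ η := by
  have htend : Tendsto (fun n : ℕ => Real.exp (η ^ 2 * n)) atTop atTop :=
    Real.tendsto_exp_atTop.comp (tendsto_natCast_atTop_atTop.const_mul_atTop (by positivity))
  obtain ⟨n₀, hn₀⟩ := eventually_atTop.1 (htend.eventually_ge_atTop (2 * s.card : ℝ))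
  -- Hoeffding gives exponent `2 * η ^ 2`; half of it absorbs the union bound factor `2 * s.card`
  -- once `n ≥ n₀`.
  refine ⟨η ^ 2, by positivity, max n₀ 1, by simp, fun n hn Ω _ P _ Z hZ hind hlaw => ?_⟩
  have hn1 : n ≠ 0 := by have := le_of_max_le_right hn; omega
  set bad : Set (Data p) → Set Ω := fun D =>
    {ω | η ≤ (empiricalMeasure fun i => Z i ω).real D - Q.real D} with hbad
  have hbadm : ∀ D, MeasurableSet D → MeasurableSet (bad D) := by
    intro D hD
    have hm : Measurable fun ω => (n : ℝ)⁻¹ * ∑ i, D.indicator (fun _ => (1 : ℝ)) (Z i ω) :=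
      (Finset.measurable_sum _ fun i _ =>
        ((measurable_const.indicator hD).comp (hZ i))).const_mul _
    simp only [hbad, measureReal_empiricalMeasure _ hD]
    exact measurableSet_le measurable_const (hm.sub_const _)
  -- A lower deviation on a set is an upper deviation on its complement.
  set U : Set Ω := ⋃ a ∈ s, (bad (C a) ∪ bad (C a)ᶜ) with hU
  have hUm : MeasurableSet U := Finset.measurableSet_biUnion _ fun a _ =>
    (hbadm _ (hC a)).union (hbadm _ (hC a).compl)
  have hUle : P.real U ≤ Real.exp (-η ^ 2 * n) := by
    have h1 : P.real U ≤ ∑ a ∈ s, 2 * Real.exp (-(2 * η ^ 2) * n) := by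
      refine (measureReal_biUnion_finset_le _ _).trans (Finset.sum_le_sum fun a _ => ?_)
      refine (measureReal_union_le _ _).trans ?_
      have h2 := measureReal_empirical_ge_le hn1 hZ hind hlaw (hC a) hη.le
      have h3 := measureReal_empirical_ge_le hn1 hZ hind hlaw (hC a).compl hη.le
      rw [two_mul]
      exact add_le_add h2 h3
    refine h1.trans ?_
    rw [Finset.sum_const, nsmul_eq_mul, ← mul_assoc, mul_comm (s.card : ℝ)]
    have h4 := hn₀ n (le_of_max_le_left hn)
    calc 2 * (s.card : ℝ) * Real.exp (-(2 * η ^ 2) * n)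
        ≤ Real.exp (η ^ 2 * n) * Real.exp (-(2 * η ^ 2) * n) := by gcongr
      _ = Real.exp (-η ^ 2 * n) := by rw [← Real.exp_add]; congr 1; ring
  refine ⟨Uᶜ, hUm.compl, ?_, fun ω hω a ha => ?_⟩
  · rw [probReal_compl_eq_one_sub hUm]
    linarith
  · have hprob := isProbabilityMeasure_empiricalMeasure hn1 fun i => Z i ω
    simp only [hU, mem_compl_iff, mem_iUnion, not_exists, mem_union, not_or] at hω
    obtain ⟨h1, h2⟩ := hω a ha
    simp only [hbad, mem_ofPred_eq, not_le, probReal_compl_eq_one_sub (hC a)] at h1 h2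
    rw [abs_le]
    constructor <;> linarith

end Hoeffding
end MetricLearning

namespace MetricLearning

open Set Filter Topology
open scoped NNReal ENNReal

/-! ### Uniform concentration and the conclusion. -/

section Main

variable {p q : ℕ} {μ : Measure ℝ} [IsFiniteMeasure μ]

/-- With exponentially high probability the empirical objective and its partial derivatives are
uniformly close to their population versions. -/
theorem exists_uniform_concentration (hμ : KernelAssumption μ) (Q : Measure (Data p))
    [IsProbabilityMeasure Q] (hQ : DataAssumption Q) (M : ℝ) {ε : ℝ} (hε : 0 < ε) :
    ∃ c > (0 : ℝ), ∃ n₀ : ℕ, n₀ ≠ 0 ∧ ∀ n ≥ n₀, ∀ (Ω : Type*) [MeasurableSpace Ω] (P : Measure Ω)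
      [IsProbabilityMeasure P] (Z : Fin n → Ω → Data p), (∀ i, Measurable (Z i)) → iIndepFun Z P →
      (∀ i, P.map (Z i) = Q) → ∃ A : Set Ω, MeasurableSet A ∧ 1 - Real.exp (-c * n) ≤ P.real A ∧
        ∀ ω ∈ A, ∀ β ∈ feasibleBox p M,
          |mlObjective μ q (empiricalMeasure fun i => Z i ω) β - mlObjective μ q Q β| ≤ ε ∧
          ∀ l, |mlPartial μ q (empiricalMeasure fun i => Z i ω) β l - mlPartial μ q Q β l| ≤ ε := by
  obtain ⟨m, hm0, m', hm⟩ := hμ.exists_Icc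
  obtain ⟨R, hR0, hR⟩ := hQ.exists_closedBall
  set K : Set (Data p) := Metric.closedBall 0 R with hK
  have hKc : IsCompact K := isCompact_closedBall _ _
  -- `none` carries the objective and `some l` its partial derivatives, so one event serves all of
  -- them.
  let G : Option (Fin p) → EuclideanSpace ℝ (Fin p) × (Data p × Data p) → ℝ := fun i x =>
    i.elim (x.2.1.2 * x.2.2.2 * kernelProfile μ (weightedNormPow q x.1 (x.2.1.1 - x.2.2.1)))
      fun l => x.2.1.2 * x.2.2.2 *
        ((∫ t, t * Real.exp (-t * weightedNormPow q x.1 (x.2.1.1 - x.2.2.1)) ∂μ) *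
          |x.2.1.1 l - x.2.2.1 l| ^ q)
  have hG : ∀ i, Continuous (G i) := by
    rintro (_ | l)
    · exact continuous_mlObjective_integrand hm
    · exact continuous_mlPartial_integrand hm l
  obtain ⟨π, η, hη, hdet⟩ := exists_simpleFunc_integral_sub_le hKc
    ⟨0, Metric.mem_closedBall_self hR0⟩ (isCompact_feasibleBox p M) hG Q hR hε
  obtain ⟨c, hc, n₀, hn₀, hconc⟩ := exists_empirical_concentration Q π.range (fun a => π ⁻¹' {a})
    (fun a => SimpleFunc.measurableSet_fiber π a) hη
  refine ⟨c, hc, n₀, hn₀, fun n hn Ω _ P _ Z hZ hind hlaw => ?_⟩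
  obtain ⟨A, hA, hPA, hdev⟩ := hconc n hn Ω P Z hZ hind hlaw
  have hKm : MeasurableSet K := hKc.measurableSet
  -- The sample is bounded only almost surely; intersecting with this event costs no probability.
  have hae : ∀ᵐ ω ∂P, ω ∈ ⋂ i, Z i ⁻¹' K := by
    simp only [mem_iInter]
    refine ae_all_iff.2 fun i => ?_
    have h := hR
    rw [← hlaw i] at h
    exact ae_of_ae_map (hZ i).aemeasurable h
  refine ⟨A ∩ ⋂ i, Z i ⁻¹' K, hA.inter (MeasurableSet.iInter fun i => hZ i hKm), ?_,
    fun ω hω β hβ => ?_⟩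
  · have : P.real (A ∩ ⋂ i, Z i ⁻¹' K) = P.real A := measureReal_congr (by
      filter_upwards [hae] with ω hω
      exact propext ⟨fun h => h.1, fun h => ⟨h, hω⟩⟩)
    rwa [this]
  · have hd := hdet (empiricalMeasure fun i => Z i ω)
      (isProbabilityMeasure_empiricalMeasure (by omega) _)
      (ae_mem_empiricalMeasure fun i => mem_iInter.1 hω.2 i) (hdev ω hω.1)
    refine ⟨?_, fun l => hd (some l) β hβ⟩
    have h0 := hd none β hβ
    rw [mlObjective, mlObjective, ← neg_sub', abs_neg]
    exact h0

end Main

end MetricLearning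

open MetricLearning in
theorem mainTheorem1 {p : ℕ} (q : ℕ) (hq : q = 1 ∨ q = 2)
    (μ : MeasureTheory.Measure ℝ) [MeasureTheory.IsFiniteMeasure μ]
    (hμ : MetricLearning.KernelAssumption μ)
    (Q : MeasureTheory.Measure (MetricLearning.Data p)) [MeasureTheory.IsProbabilityMeasure Q]
    (hQ : MetricLearning.DataAssumption Q)
    (S : Finset (Fin p)) (hS : MetricLearning.IsSignalSet Q S) (hSne : S.Nonempty)
    (M : ℝ) (β₀ : EuclideanSpace ℝ (Fin p)) (hβ₀ : β₀ ∈ MetricLearning.feasibleBox p M)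
    (hβ₀supp : MetricLearning.coordSupport β₀ = Set.univ) :
    ∃ c > (0 : ℝ), ∃ τ > (0 : ℝ), ∃ n₀ : ℕ, ∀ n ≥ n₀,
      ∀ (Ω : Type*) [MeasurableSpace Ω] (P : MeasureTheory.Measure Ω)
        [MeasureTheory.IsProbabilityMeasure P] (Z : Fin n → Ω → MetricLearning.Data p),
        (∀ i, Measurable (Z i)) → ProbabilityTheory.iIndepFun Z P →
        (∀ i, MeasureTheory.Measure.map (Z i) P = Q) →
        ∃ A : Set Ω, MeasurableSet A ∧ 1 - Real.exp (-c * n) ≤ P.real A ∧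
          ∀ ω ∈ A,
            (∃ β : ℝ → EuclideanSpace ℝ (Fin p),
              MetricLearning.IsProjectedGradientFlow
                (MetricLearning.mlObjective μ q
                  (MetricLearning.empiricalMeasure fun i => Z i ω))
                (MetricLearning.feasibleBox p M) β₀ β) ∧
            ∀ β : ℝ → EuclideanSpace ℝ (Fin p),
              MetricLearning.IsProjectedGradientFlow
                (MetricLearning.mlObjective μ q
                  (MetricLearning.empiricalMeasure fun i => Z i ω))
                (MetricLearning.feasibleBox p M) β₀ β →
              ∀ t ≥ τ, (MetricLearning.coordSupport (β t)).Nonempty ∧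
                MetricLearning.coordSupport (β t) ⊆ (S : Set (Fin p)) := by
  obtain ⟨l₀, hl₀⟩ := hSne
  have : Nonempty (Fin p) := ⟨l₀⟩
  have hM : 0 ≤ M := (hβ₀ l₀).1.trans (hβ₀ l₀).2
  have hβ₀pos : ∀ i, 0 < β₀ i := fun i => (hβ₀ i).1.lt_of_ne' (by
    have : i ∈ coordSupport β₀ := hβ₀supp ▸ Set.mem_univ i
    exact this)
  obtain ⟨m, hm0, m', hm⟩ := hμ.exists_Icc
  have hδ := mlObjective_neg hq hμ hQ hS ⟨l₀, hl₀⟩ hβ₀pos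
  set δ := -mlObjective μ q Q β₀ with hδ_def
  have hδ0 : 0 < δ := neg_pos.2 hδ
  have hex : ∀ l, ∃ κ > 0, l ∉ S → ∀ β ∈ feasibleBox p M,
      κ * -mlObjective μ q Q β ≤ mlPartial μ q Q β l := by
    intro l
    by_cases hl : l ∈ S
    · exact ⟨1, one_pos, fun h => absurd hl h⟩
    · obtain ⟨κ, hκ, h⟩ := exists_mul_neg_mlObjective_le hq hμ hQ hS.1 M l hl
      exact ⟨κ, hκ, fun _ => h⟩
  choose κ' hκ'pos hκ' using hex
  obtain ⟨l₁, hl₁⟩ := Finite.exists_min κ'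
  set κ := κ' l₁ with hκ_def
  have hκ0 : 0 < κ := hκ'pos l₁
  -- Two errors of size `δ / 4` keep the population objective below `-δ / 2` along the flow. The
  -- noise derivative is then at least `κ * δ / 2`, and an error `κ * δ / 4` leaves `κ * δ / 4`.
  set ε := min (δ / 4) (κ * δ / 4) with hε
  have hε0 : 0 < ε := lt_min (by positivity) (by positivity)
  have hε1 : ε ≤ δ / 4 := min_le_left _ _
  have hε2 : ε ≤ κ * δ / 4 := min_le_right _ _
  obtain ⟨c, hc, n₀, hn₀, hconc⟩ := exists_uniform_concentration (q := q) hμ Q hQ M hε0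
  refine ⟨c, hc, M / (κ * δ / 4) + 1, by positivity, n₀, fun n hn Ω _ P _ Z hZ hind hlaw => ?_⟩
  obtain ⟨A, hA, hPA, hdev⟩ := hconc n hn Ω P Z hZ hind hlaw
  refine ⟨A, hA, hPA, fun ω hω => ?_⟩
  have hn0 : n ≠ 0 := by omega
  set F := mlObjective μ q (empiricalMeasure fun i => Z i ω) with hF
  have hFc : ContDiff ℝ 1 F := contDiff_mlObjective_empiricalMeasure hm hn0 _
  have hgrad : Continuous (gradient F) :=
    (InnerProductSpace.toDual ℝ _).symm.continuous.comp (hFc.continuous_fderiv one_ne_zero)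
  have hBc := isCompact_feasibleBox p M
  have hBconv := convex_feasibleBox p M
  have hdevω := hdev ω hω
  refine ⟨?_, fun β hβ t ht => ?_⟩
  · obtain ⟨x, hx⟩ := exists_solvesInclusion hBc hBconv hβ₀ hgrad.continuousOn
    exact ⟨x, hβ₀, hx⟩
  obtain ⟨-, -, -, hmem, -⟩ := hβ.regularity hBc.isClosed
  have henergy : ∀ s, 0 ≤ s → F (β s) ≤ -(δ - ε) := by
    intro s hs
    have h1 := hβ.le_initial hBc hBconv hFc hs
    have h2 := (abs_le.1 (hdevω β₀ hβ₀).1).2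
    linarith
  have ht0 : 0 ≤ t := le_trans (by positivity) ht
  constructor
  · by_contra hempty
    rw [Set.not_nonempty_iff_eq_empty] at hempty
    have hzero : β t = 0 := by
      ext j
      by_contra hj
      have : j ∈ coordSupport (β t) := hj
      rw [hempty] at this
      exact this
    -- At the origin the empirical objective is at least `-ε`, while along the flow it is at most
    -- `-(δ - ε)`; these are incompatible since `2 * ε < δ`.
    have h1 := henergy t ht0
    have h2 := (abs_le.1 (hdevω 0 fun i => ⟨le_rfl, hM⟩).1).1
    rw [mlObjective_zero hQ] at h2
    rw [hzero] at h1
    linarith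
  · intro j hj
    by_contra hjS
    refine hj (hβ.coord_eq_zero (κ := κ * δ / 4) (by positivity) j (fun s hs => ?_) ht)
    rw [gradient_mlObjective_empiricalMeasure hm hn0]
    obtain ⟨h1, h2⟩ := hdevω (β s) (hmem s hs)
    have h3 := henergy s hs
    have h4 := hκ' j hjS (β s) (hmem s hs)
    have h5 : δ / 2 ≤ -mlObjective μ q Q (β s) := by linarith [(abs_le.1 h1).1]
    have h6 : κ * (δ / 2) ≤ κ' j * -mlObjective μ q Q (β s) :=
      mul_le_mul (hl₁ j) h5 (by positivity) (hκ'pos j).le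
    linarith [(abs_le.1 (h2 j)).1]
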